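/- Let $d\ge 1$, identify $\mathbb C^d\cong\mathbb R^{2d}$ via $z=x+iy$ (with Lebesgue measure and Euclidean norm), and let $$\mathcal L=-\sum_{j=1}^d\Big(\big(\tfrac{\partial}{\partial x_j}-\tfrac i2y_j\big)^2+\big(\tfrac{\partial}{\partial y_j}+\tfrac i2x_j\big)^2\Big)$$ be the twisted Laplacian, as a self-adjoint operator on $L^2(\mathbb C^d)$ (acting in the sense of distributions). Its spectrum is pure point, and for a bounded function $m$ we set $m(\mathcal L)=\sum_\lambda m(\lambda)\mathcal P_\lambda$, where $\mathcal P_\lambda$ is the orthogonal projection of $L^2(\mathbb C^d)$ onto the eigenspace of $\mathcal L$ for the eigenvalue $\lambda$. For every $N>0$ and $c>0$ there are $M\in\mathbb N$ and $C>0$, depending only on $d,N,c$, such that the following holds for all $\eta\in C_c^\infty((-2,2))$, all $\mu\ge1$ and all $R>0$. Put $A=\max_{0\le k\le M}\|\eta^{(k)}\|_{\infty}$. The operator $\eta((\mu-\mathcal L)/R)$ has a continuous integral kernel, and every continuous integral kernel $\eta((\mu-\mathcal L)/R)(z,z')$ of it satisfies, for all $z,z'\in\mathbb C^d$: 1. if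 $R\ge\mu$ and $|z-z'|\ge c\,R^{-1/2}$, then $|\eta((\mu-\mathcal L)/R)(z,z')|\le C A\,R^d\,(1+R^{1/2}|z-z'|)^{-N}$; 2. if $1\le R<\mu$ and $|z-z'|\ge c\,\mu^{1/2}R^{-1}$, then $|\eta((\mu-\mathcal L)/R)(z,z')|\le C A\,R^d\,(1+R\mu^{-1/2}|z-z'|)^{-N}$; 3. if $R<1$ and $|z-z'|\ge c\,\mu^{1/2}$, then $|\eta((\mu-\mathcal L)/R)(z,z')|\le C A\,(1+\mu^{-1/2}|z-z'|)^{-N}$. -/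

import Mathlib

open MeasureTheory
open scoped SchwartzMap LineDeriv ContDiff

namespace TwistedLaplacian

/-- The space `ℂ^d ≅ ℝ^{2d}` with its Euclidean norm and Lebesgue measure; a point is `z = x + i y`
with `x_j = (z j).re`, `y_j = (z j).im`. -/
abbrev Cn (d : ℕ) : Type := EuclideanSpace ℂ (Fin d)

/-- The Hilbert space `L²(ℂ^d)`. -/
abbrev L2 (d : ℕ) : Type := Lp ℂ 2 (volume : Measure (Cn d))

/-- `∂/∂x_j - (i/2) y_j`. -/
noncomputable def opX {d : ℕ} (j : Fin d) (f : Cn d → ℂ) (z : Cn d) : ℂ :=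
  lineDeriv ℝ f z (EuclideanSpace.single j (1 : ℂ)) - Complex.I / 2 * ((z j).im : ℂ) * f z

/-- `∂/∂y_j + (i/2) x_j`. -/
noncomputable def opY {d : ℕ} (j : Fin d) (f : Cn d → ℂ) (z : Cn d) : ℂ :=
  lineDeriv ℝ f z (EuclideanSpace.single j Complex.I) + Complex.I / 2 * ((z j).re : ℂ) * f z

/-- The twisted Laplacian `-∑_j ((∂/∂x_j - (i/2) y_j)² + (∂/∂y_j + (i/2) x_j)²)`. -/
noncomputable def twistedLaplacian {d : ℕ} (f : Cn d → ℂ) (z : Cn d) : ℂ :=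
  -∑ j : Fin d, (opX j (opX j f) z + opY j (opY j f) z)

lemma exists_opX_eq {d : ℕ} (j : Fin d) (φ : 𝓢(Cn d, ℂ)) :
    ∃ ψ : 𝓢(Cn d, ℂ), ⇑ψ = opX j φ := by
  let L : Cn d →L[ℝ] ℂ :=
    Complex.ofRealCLM ∘L Complex.imCLM ∘L ((EuclideanSpace.proj j : Cn d →L[ℂ] ℂ).restrictScalars ℝ)
  have hL : Function.HasTemperateGrowth (fun z : Cn d => ((z j).im : ℂ)) :=
    L.hasTemperateGrowth
  refine ⟨∂_{(EuclideanSpace.single j (1 : ℂ) : Cn d)} φ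
    - (Complex.I / 2) • SchwartzMap.smulLeftCLM ℂ (fun z : Cn d => ((z j).im : ℂ)) φ, ?_⟩
  funext z
  simp [opX, SchwartzMap.lineDerivOp_apply, SchwartzMap.smulLeftCLM_apply_apply hL, mul_assoc]

lemma exists_opY_eq {d : ℕ} (j : Fin d) (φ : 𝓢(Cn d, ℂ)) :
    ∃ ψ : 𝓢(Cn d, ℂ), ⇑ψ = opY j φ := by
  let L : Cn d →L[ℝ] ℂ :=
    Complex.ofRealCLM ∘L Complex.reCLM ∘L ((EuclideanSpace.proj j : Cn d →L[ℂ] ℂ).restrictScalars ℝ)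
  have hL : Function.HasTemperateGrowth (fun z : Cn d => ((z j).re : ℂ)) :=
    L.hasTemperateGrowth
  refine ⟨∂_{(EuclideanSpace.single j Complex.I : Cn d)} φ
    + (Complex.I / 2) • SchwartzMap.smulLeftCLM ℂ (fun z : Cn d => ((z j).re : ℂ)) φ, ?_⟩
  funext z
  simp [opY, SchwartzMap.lineDerivOp_apply, SchwartzMap.smulLeftCLM_apply_apply hL, mul_assoc]

/-- The twisted Laplacian maps Schwartz functions to Schwartz functions. -/
lemma exists_twistedLaplacian_eq {d : ℕ} (φ : 𝓢(Cn d, ℂ)) :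
    ∃ ψ : 𝓢(Cn d, ℂ), ⇑ψ = twistedLaplacian φ := by
  choose X hX using fun j : Fin d => exists_opX_eq j (φ := φ)
  choose XX hXX using fun j : Fin d => exists_opX_eq j (φ := X j)
  choose Y hY using fun j : Fin d => exists_opY_eq j (φ := φ)
  choose YY hYY using fun j : Fin d => exists_opY_eq j (φ := Y j)
  refine ⟨-∑ j : Fin d, (XX j + YY j), ?_⟩
  funext z
  simp [twistedLaplacian, hXX, hX, hYY, hY]

lemma memLp_twistedLaplacian {d : ℕ} (φ : 𝓢(Cn d, ℂ)) :
    MemLp (twistedLaplacian φ) 2 (volume : Measure (Cn d)) := by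
  obtain ⟨ψ, hψ⟩ := exists_twistedLaplacian_eq φ
  exact hψ ▸ ψ.memLp 2

/-- The eigenspace in `L²(ℂ^d)` of the self-adjoint operator given by the twisted Laplacian `𝓛`, for
the real number `lam`. The self-adjoint operator is the adjoint of `𝓛` on Schwartz functions,
that is, `𝓛` acting on `L²` functions in the sense of distributions; its eigenspace is the
orthogonal complement of the range of `𝓛 - lam` on Schwartz functions. See `mem_eigenspace_iff`
for the weak formulation. -/
noncomputable def eigenspace (d : ℕ) (lam : ℝ) : Submodule ℂ (L2 d) :=
  (Submodule.span ℂ (Set.range fun φ : 𝓢(Cn d, ℂ) =>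
    (memLp_twistedLaplacian φ).toLp - (lam : ℂ) • (φ.memLp 2 (volume : Measure (Cn d))).toLp))ᗮ

/-- Membership in the eigenspace: `⟨f, 𝓛 φ⟩ = lam ⟨f, φ⟩` for all Schwartz functions `φ`. -/
lemma mem_eigenspace_iff {d : ℕ} (lam : ℝ) (f : L2 d) :
    f ∈ eigenspace d lam ↔ ∀ φ : 𝓢(Cn d, ℂ),
      ∫ z, f z * starRingEnd ℂ (twistedLaplacian φ z) =
        (lam : ℂ) * ∫ z, f z * starRingEnd ℂ (φ z) := by
  have key : ∀ (g : Cn d → ℂ) (hg : MemLp g 2 (volume : Measure (Cn d))),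
      inner ℂ hg.toLp f = ∫ z, f z * starRingEnd ℂ (g z) := by
    intro g hg
    rw [L2.inner_def]
    refine integral_congr_ae ?_
    filter_upwards [hg.coeFn_toLp] with z hz
    simp [hz]
  unfold eigenspace
  rw [Submodule.mem_orthogonal]
  constructor
  · intro h φ
    have h1 := h _ (Submodule.subset_span (Set.mem_range_self φ))
    rw [inner_sub_left, inner_smul_left, key, key, Complex.conj_ofReal] at h1
    exact sub_eq_zero.mp h1
  · intro h u hu
    induction hu using Submodule.span_induction with
    | mem x hx =>
      obtain ⟨φ, rfl⟩ := hx
      rw [inner_sub_left, inner_smul_left, key, key, Complex.conj_ofReal, h φ, sub_self]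
    | zero => simp
    | add x y _ _ hx hy => rw [inner_add_left, hx, hy, add_zero]
    | smul a x _ hx => rw [inner_smul_left, hx, mul_zero]

instance {d : ℕ} (lam : ℝ) : (eigenspace d lam).HasOrthogonalProjection := by
  unfold eigenspace; infer_instance

/-- The spectral projection `𝓟_lam`: the orthogonal projection of `L²(ℂ^d)` onto the eigenspace. -/
noncomputable def spectralProj (d : ℕ) (lam : ℝ) : L2 d →L[ℂ] L2 d :=
  (eigenspace d lam).starProjection

/-- The spectral multiplier `m(𝓛) f = ∑_lam m(lam) 𝓟_lam f`, the sum in `L²` over the eigenvalues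
`lam` of `𝓛`, which has pure point spectrum (`𝓟_lam = 0` when `lam` is not an eigenvalue). -/
noncomputable def multiplier (d : ℕ) (m : ℝ → ℂ) (f : L2 d) : L2 d :=
  ∑' lam : ℝ, m lam • spectralProj d lam f

/-- `K` is an integral kernel of the operator `T` on `L²(ℂ^d)`: `T f (z) = ∫ K(z, w) f(w) dw`. -/
def IsKernel {d : ℕ} (T : L2 d → L2 d) (K : Cn d → Cn d → ℂ) : Prop :=
  ∀ f : L2 d, ∀ᵐ z : Cn d, Integrable (fun w => K z w * f w) ∧ T f z = ∫ w, K z w * f w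

end TwistedLaplacian

open TwistedLaplacian

/-! Write α = d - 1 and s = |z - z'|. The eigenvalues of 𝓛 are d + 2k, and the projection onto each
eigenspace has kernel (2π)^{-d} L_k^α(s²/2) e^{-s²/4} times a unimodular phase independent of k. The
kernel of η((μ - 𝓛)/R) is therefore bounded by a finite sum Σ a_k L_k^α(s²/2) e^{-s²/4} with a_k =
η((μ - d - 2k)/R).

Decay comes from summation by parts. Multiplication by x = s²/2 acts on Laguerre coefficients as the
second-order difference operator `mulVar`, a ↦ -k Δ²a(k-1) - d Δa(k). Put ρ = max(1, R) and κ =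
max(μ, ρ). Each difference of a gains ρ⁻¹, and |k| ≲ κ on the support, so each factor x costs κ/ρ²
(`norm_mulVar_iter_le`): this is decay in ρs/√κ. The size ρ^d arises because about ρ indices
contribute and each Laguerre function is ≲ (√κ/s)^α (`pow_mul_abs_laguerre_mul_exp_le`), which is ≲
ρ^α as soon as s ≥ c√κ/ρ. The two are combined in `exists_norm_sum_laguerre_le`; the three cases of
the theorem are three values of (ρ, κ). The pointwise Laguerre bound is one entry of a unitary
matrix (`hasSum_displacementCoeff`).

To identify the projections, twisted translates of Laguerre functions are shown to be Schwartz
eigenfunctions; an element f of the λ-eigenspace pairs to zero with those of any other eigenvalue.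
By the Laguerre generating function, the Abel sum Σ r^k projKernel_k is an explicit Gaussian, an
approximate identity as r → 1. Hence f is recovered from a single term, or is zero when λ is not of
the form d + 2k (`spectralProj_ae_eq`, `spectralProj_eq_zero`). Uniqueness of continuous kernels
transfers the estimate to an arbitrary one. -/

namespace TwistedLaplacian

/-! ### Laguerre polynomials: recurrences and differential equation -/

/-- The generalized Laguerre polynomial `L_k^{(α)}` for a natural parameter `α`. -/
noncomputable def laguerre (α k : ℕ) (x : ℝ) : ℝ :=
  ∑ i ∈ Finset.range (k + 1), (-1) ^ i * ((k + α).choose (α + i) : ℝ) / (i.factorial : ℝ) * x ^ i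

lemma laguerre_eq_sum_range {α k n : ℕ} (h : k < n) (x : ℝ) :
    laguerre α k x = ∑ i ∈ Finset.range n,
      (-1) ^ i * ((k + α).choose (α + i) : ℝ) / (i.factorial : ℝ) * x ^ i := by
  unfold laguerre
  refine Finset.sum_subset (Finset.range_subset_range.2 h) fun i _ hi => ?_
  rw [Finset.mem_range, not_lt] at hi
  rw [Nat.choose_eq_zero_of_lt (by omega)]
  simp

@[simp] lemma laguerre_zero (α : ℕ) (x : ℝ) : laguerre α 0 x = 1 := by
  simp [laguerre]

lemma laguerre_succ_succ (α k : ℕ) (x : ℝ) :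
    laguerre (α + 1) (k + 1) x = laguerre (α + 1) k x + laguerre α (k + 1) x := by
  rw [laguerre_eq_sum_range (n := k + 2) (by omega), laguerre_eq_sum_range (n := k + 2) (by omega),
    laguerre_eq_sum_range (n := k + 2) (by omega), ← Finset.sum_add_distrib]
  refine Finset.sum_congr rfl fun i _ => ?_
  have h : (k + 1 + (α + 1)).choose (α + 1 + i) =
      (k + (α + 1)).choose (α + 1 + i) + (k + 1 + α).choose (α + i) := by
    rw [show k + 1 + (α + 1) = (k + 1 + α) + 1 by ring, show α + 1 + i = (α + i) + 1 by ring,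
      Nat.choose_succ_succ, show k + (α + 1) = k + 1 + α by ring, add_comm]
  rw [h]; push_cast; ring

/-- Follows by comparing coefficients. It is the source of the three-term recurrence, of Laguerre's
equation and of the link with `displacementCoeff`. -/
lemma mul_laguerre_succ (α k : ℕ) (x : ℝ) :
    x * laguerre (α + 1) k x =
      (k + α + 1) * laguerre α k x - (k + 1) * laguerre α (k + 1) x := by
  -- At i = k + 1 both sides vanish, the right one through its factor k + 1 - i; beyond that both
  -- binomials are zero.
  have key : ∀ i : ℕ, ((k + α + 1 : ℕ) : ℝ) * (k + α).choose (α + i) =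
      (k + 1 - i : ℝ) * (k + 1 + α).choose (α + i) := by
    intro i
    rcases le_or_gt (α + i) (k + α + 1) with h | h
    · have := Nat.choose_mul_succ_eq (k + α) (α + i)
      rw [show k + 1 + α = k + α + 1 by ring]
      have h2 : ((k + α + 1 - (α + i) : ℕ) : ℝ) = k + 1 - i := by
        rw [Nat.cast_sub h]; push_cast; ring
      rw [← h2]
      have h3 : ((k + α + 1 : ℕ) : ℝ) * (k + α).choose (α + i) =
        (((k + α).choose (α + i) * (k + α + 1) : ℕ) : ℝ) := by push_cast; ring
      rw [h3, this]; push_cast; ring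
    · rw [Nat.choose_eq_zero_of_lt (by omega), Nat.choose_eq_zero_of_lt (by omega)]; simp
  rw [laguerre_eq_sum_range (α := α) (k := k) (n := k + 2) (by omega),
    laguerre_eq_sum_range (α := α) (k := k + 1) (n := k + 2) (by omega), Finset.mul_sum,
    Finset.mul_sum, ← Finset.sum_sub_distrib, Finset.sum_range_succ', laguerre, Finset.mul_sum]
  have h0 := key 0
  push_cast at h0
  simp only [add_zero, sub_zero] at h0 ⊢
  have h00 : ((k : ℝ) + α + 1) * ((-1) ^ 0 * ((k + α).choose α : ℝ) / (Nat.factorial 0 : ℝ) * x ^ 0)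
      - (k + 1) * ((-1) ^ 0 * ((k + 1 + α).choose α : ℝ) / (Nat.factorial 0 : ℝ) * x ^ 0) = 0 := by
    simp; linarith
  rw [h00, add_zero]
  refine Finset.sum_congr rfl fun i _ => ?_
  have h1 := key (i + 1)
  push_cast at h1
  have hf : (i.factorial : ℝ) ≠ 0 := by positivity
  have hi : (i : ℝ) + 1 ≠ 0 := by positivity
  rw [Nat.factorial_succ, show k + (α + 1) = k + 1 + α by ring, show α + 1 + i = α + (i + 1) by ring]
  push_cast
  field_simp
  rw [pow_succ (-1 : ℝ)]
  linear_combination ((-1 : ℝ) ^ i * x ^ (i + 1)) * h1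

/-- The three-term recurrence. -/
lemma mul_laguerre (α k : ℕ) (x : ℝ) :
    x * laguerre α (k + 1) x = -(k + 2) * laguerre α (k + 2) x
      + (2 * (k + 1) + α + 1) * laguerre α (k + 1) x - (k + 1 + α) * laguerre α k x := by
  have h1 := mul_laguerre_succ α (k + 1) x
  have h2 := mul_laguerre_succ α k x
  have h3 := laguerre_succ_succ α k x
  push_cast at h1
  linear_combination h1 - h2 - x * h3

lemma mul_laguerre_zero (α : ℕ) (x : ℝ) :
    x * laguerre α 0 x = -laguerre α 1 x + (α + 1) * laguerre α 0 x := by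
  have h := mul_laguerre_succ α 0 x
  simp at h ⊢
  linear_combination h

lemma hasDerivAt_laguerre_zero (α : ℕ) (x : ℝ) : HasDerivAt (laguerre α 0) 0 x := by
  rw [show laguerre α 0 = fun _ => 1 from funext fun y => laguerre_zero α y]
  exact hasDerivAt_const x 1

lemma hasDerivAt_laguerre_succ (α k : ℕ) (x : ℝ) :
    HasDerivAt (laguerre α (k + 1)) (-laguerre (α + 1) k x) x := by
  have h : HasDerivAt (fun y => ∑ i ∈ Finset.range (k + 2),
      (-1) ^ i * ((k + 1 + α).choose (α + i) : ℝ) / (i.factorial : ℝ) * y ^ i)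
      (∑ i ∈ Finset.range (k + 2),
      (-1) ^ i * ((k + 1 + α).choose (α + i) : ℝ) / (i.factorial : ℝ) * ((i : ℝ) * x ^ (i - 1))) x :=
    HasDerivAt.fun_sum fun i _ => (hasDerivAt_pow i x).const_mul _
  refine h.congr_deriv ?_
  rw [Finset.sum_range_succ', laguerre, ← Finset.sum_neg_distrib]
  simp only [Nat.cast_zero, zero_mul, mul_zero, add_zero]
  refine Finset.sum_congr rfl fun i _ => ?_
  have hf : (i.factorial : ℝ) ≠ 0 := by positivity
  have hi : (i : ℝ) + 1 ≠ 0 := by positivity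
  rw [Nat.factorial_succ, show k + (α + 1) = k + 1 + α by ring, show α + 1 + i = α + (i + 1) by ring]
  push_cast
  field_simp
  ring

lemma differentiable_laguerre (α k : ℕ) : Differentiable ℝ (laguerre α k) := by
  intro x
  cases k with
  | zero => exact (hasDerivAt_laguerre_zero α x).differentiableAt
  | succ k => exact (hasDerivAt_laguerre_succ α k x).differentiableAt

/-- Laguerre's differential equation. -/
lemma laguerre_ode (α k : ℕ) : ∃ p₁ p₂ : ℝ → ℝ, (∀ x, HasDerivAt (laguerre α k) (p₁ x) x) ∧
    (∀ x, HasDerivAt p₁ (p₂ x) x) ∧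
    ∀ x, x * p₂ x + (α + 1 - x) * p₁ x + k * laguerre α k x = 0 := by
  match k with
  | 0 => exact ⟨fun _ => 0, fun _ => 0, hasDerivAt_laguerre_zero α,
      fun x => hasDerivAt_const x 0, fun x => by simp⟩
  | 1 =>
    refine ⟨fun x => -laguerre (α + 1) 0 x, fun _ => -0, hasDerivAt_laguerre_succ α 0,
      fun x => (hasDerivAt_laguerre_zero (α + 1) x).neg, fun x => ?_⟩
    have h := mul_laguerre_succ α 0 x
    simp at h ⊢
    linear_combination h
  | k + 2 =>
    refine ⟨fun x => -laguerre (α + 1) (k + 1) x, fun x => - -laguerre (α + 2) k x,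
      hasDerivAt_laguerre_succ α (k + 1),
      fun x => (hasDerivAt_laguerre_succ (α + 1) k x).neg, fun x => ?_⟩
    have h1 := mul_laguerre_succ (α + 1) k x
    have h2 := mul_laguerre_succ α (k + 1) x
    have h3 := laguerre_succ_succ α k x
    push_cast at h1 h2 ⊢
    linear_combination h1 + h2 + (-(α:ℝ) - k - 2) * h3

/-! ### Pointwise bounds for Laguerre polynomials -/

/-- The coefficient of `s ^ m` in `exp (t s) (s - t) ^ n`. -/
noncomputable def displacementCoeff (t : ℝ) : ℕ → ℕ → ℝ
  | 0, m => t ^ m / (m.factorial : ℝ)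
  | n + 1, 0 => -t * displacementCoeff t n 0
  | n + 1, m + 1 => displacementCoeff t n m - t * displacementCoeff t n (m + 1)

/-- The recursion in n becomes `mul_laguerre_succ` at x = t². -/
lemma displacementCoeff_eq_laguerre (t : ℝ) (k α : ℕ) :
    displacementCoeff t k (k + α) =
      t ^ α * (k.factorial / (k + α).factorial : ℝ) * laguerre α k (t ^ 2) := by
  induction k generalizing α with
  | zero => simp [displacementCoeff]; ring
  | succ k ih =>
    rw [show k + 1 + α = (k + α) + 1 by ring, displacementCoeff, ih α,
      show k + α + 1 = k + (α + 1) by ring, ih (α + 1)]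
    have h := mul_laguerre_succ α k (t ^ 2)
    rw [show k + (α + 1) = (k + α) + 1 by ring, Nat.factorial_succ (k + α), Nat.factorial_succ k]
    have hf : ((k + α).factorial : ℝ) ≠ 0 := by positivity
    have hf' : ((k : ℝ) + α + 1) ≠ 0 := by positivity
    push_cast
    field_simp
    linear_combination (-t ^ α) * h

lemma displacementCoeff_lower_zero (t : ℝ) (m : ℕ) :
    (m + 1) * displacementCoeff t 0 (m + 1) = t * displacementCoeff t 0 m := by
  simp only [displacementCoeff, Nat.factorial_succ]
  push_cast
  field_simp
  ring

/-- The product rule: the derivative of e^{ts}(s - t)^{n+1} is t times itself plus (n + 1) e^{ts}(s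
- t)^n. -/
lemma displacementCoeff_lower (t : ℝ) (n m : ℕ) :
    (m + 1) * displacementCoeff t (n + 1) (m + 1) =
      t * displacementCoeff t (n + 1) m + (n + 1) * displacementCoeff t n m := by
  induction n generalizing m with
  | zero =>
    cases m with
    | zero =>
      have h := displacementCoeff_lower_zero t 0
      simp only [displacementCoeff] at h ⊢
      simp at h ⊢; ring
    | succ m =>
      have h1 := displacementCoeff_lower_zero t m
      have h2 := displacementCoeff_lower_zero t (m + 1)
      rw [displacementCoeff.eq_3 t 0 (m + 1), displacementCoeff.eq_3 t 0 m]
      push_cast at h1 h2 ⊢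
      linear_combination h1 - t * h2
  | succ n ih =>
    cases m with
    | zero =>
      have h2 := ih 0
      have e1 := displacementCoeff.eq_3 t (n + 1) 0
      have e2 := displacementCoeff.eq_2 t (n + 1)
      have e3 := displacementCoeff.eq_2 t n
      simp only [zero_add, Nat.cast_zero, one_mul] at h2 e1 ⊢
      push_cast
      linear_combination e1 - t * e2 - t * h2 - (n + 1) * e3
    | succ m =>
      have h1 := ih m
      have h2 := ih (m + 1)
      rw [displacementCoeff.eq_3 t (n + 1) (m + 1), displacementCoeff.eq_3 t (n + 1) m]
      have h3 := displacementCoeff.eq_3 t n m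
      push_cast at h1 h2 ⊢
      linear_combination h1 - t * h2 - (n + 1) * h3

/-- For ⟨f, g⟩ = Σ m! f_m g_m, differentiation is adjoint to multiplication by s. With f_n =
e^{ts}(s - t)^n this gives ‖f_{n+1}‖² = ⟨f_{n+1}', f_n⟩ - t⟨f_{n+1}, f_n⟩ = (n + 1)‖f_n‖². The
second conclusion, with its extra weight m, keeps s f_n in the space during the induction. -/
lemma hasSum_displacementCoeff (t : ℝ) (n : ℕ) :
    HasSum (fun m => (m.factorial : ℝ) * displacementCoeff t n m ^ 2)
      (n.factorial * Real.exp (t ^ 2)) ∧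
    Summable (fun m : ℕ => (m : ℝ) * ((m.factorial : ℝ) * displacementCoeff t n m ^ 2)) := by
  have aux : ∀ a b : ℕ → ℝ, ∀ x y : ℝ, Summable (fun m => (m.factorial : ℝ) * a m ^ 2) →
      Summable (fun m => (m.factorial : ℝ) * b m ^ 2) →
      Summable (fun m => (m.factorial : ℝ) * (x * a m + y * b m) ^ 2) := by
    intro a b x y ha hb
    refine Summable.of_nonneg_of_le (fun m => by positivity) (fun m => ?_)
      ((ha.mul_left (2 * x ^ 2)).add (hb.mul_left (2 * y ^ 2)))
    have : (x * a m + y * b m) ^ 2 ≤ 2 * (x * a m) ^ 2 + 2 * (y * b m) ^ 2 := by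
      nlinarith [sq_nonneg (x * a m - y * b m)]
    calc _ ≤ (m.factorial : ℝ) * (2 * (x * a m) ^ 2 + 2 * (y * b m) ^ 2) := by gcongr
      _ = _ := by ring
  have aux2 : ∀ a b : ℕ → ℝ, Summable (fun m => (m.factorial : ℝ) * a m ^ 2) →
      Summable (fun m => (m.factorial : ℝ) * b m ^ 2) →
      Summable (fun m => (m.factorial : ℝ) * (a m * b m)) := by
    intro a b ha hb
    refine Summable.of_norm_bounded (ha.add hb) fun m => ?_
    rw [Real.norm_eq_abs, abs_mul, Nat.abs_cast, ← mul_add]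
    gcongr
    rw [abs_le]
    constructor <;> nlinarith [sq_nonneg (a m + b m), sq_nonneg (a m - b m)]
  have low : ∀ n, ∀ m : ℕ, ((m + 1 : ℕ) : ℝ) * (((m + 1).factorial : ℝ) *
      displacementCoeff t n (m + 1) ^ 2) =
      (m.factorial : ℝ) * (((m : ℝ) + 1) * displacementCoeff t n (m + 1)) ^ 2 := by
    intro n m
    rw [Nat.factorial_succ]; push_cast; ring
  induction n with
  | zero =>
    have h0 : HasSum (fun m => (m.factorial : ℝ) * displacementCoeff t 0 m ^ 2)
        ((Nat.factorial 0 : ℕ) * Real.exp (t ^ 2)) := by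
      have := NormedSpace.expSeries_div_hasSum_exp (t ^ 2)
      rw [← Real.exp_eq_exp_ℝ] at this
      convert! this using 1
      · funext m
        simp only [displacementCoeff]
        have hf : (m.factorial : ℝ) ≠ 0 := by positivity
        field_simp
        ring
      · simp
    refine ⟨h0, ?_⟩
    rw [← summable_nat_add_iff 1]
    simp_rw [low, displacementCoeff_lower_zero]
    simpa using aux _ (displacementCoeff t 0) t 0 h0.summable h0.summable
  | succ n ih =>
    obtain ⟨h1, h2⟩ := ih
    have s1 : Summable (fun m => (m.factorial : ℝ) * displacementCoeff t (n + 1) m ^ 2) := by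
      rw [← summable_nat_add_iff 1]
      have h3 := (summable_nat_add_iff 1).2 h1.summable
      refine Summable.of_nonneg_of_le (fun m => by positivity) (fun m => ?_)
        (((h2.add h1.summable).mul_left 2).add (h3.mul_left (2 * t ^ 2)))
      simp only [displacementCoeff]
      have : (displacementCoeff t n m - t * displacementCoeff t n (m + 1)) ^ 2 ≤
        2 * displacementCoeff t n m ^ 2 + 2 * (t * displacementCoeff t n (m + 1)) ^ 2 := by
        nlinarith [sq_nonneg (displacementCoeff t n m + t * displacementCoeff t n (m + 1))]
      calc _ ≤ ((m + 1).factorial : ℝ) * (2 * displacementCoeff t n m ^ 2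
            + 2 * (t * displacementCoeff t n (m + 1)) ^ 2) := by gcongr
        _ = _ := by rw [Nat.factorial_succ]; push_cast; ring
    have s2 := aux2 _ _ s1 h1.summable
    -- ⟨f_{n+1}, s f_n⟩, evaluated as ⟨f_{n+1}', f_n⟩.
    have s3 : HasSum (fun m => ((m + 1).factorial : ℝ) *
        (displacementCoeff t (n + 1) (m + 1) * displacementCoeff t n m))
        ((n + 1) * (n.factorial * Real.exp (t ^ 2)) +
          t * ∑' m, (m.factorial : ℝ) * (displacementCoeff t (n + 1) m * displacementCoeff t n m)) := by
      convert! (h1.mul_left ((n : ℝ) + 1)).add (s2.hasSum.mul_left t) using 1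
      funext m
      rw [Nat.factorial_succ]; push_cast
      have := displacementCoeff_lower t n m
      linear_combination (m.factorial : ℝ) * displacementCoeff t n m * this
    constructor
    · have s4 := s2.hasSum.mul_left t
      rw [← hasSum_nat_add_iff' 1] at s4
      rw [← hasSum_nat_add_iff' 1]
      convert! s3.sub s4 using 1
      · funext m
        rw [displacementCoeff]; ring
      · simp [displacementCoeff, Nat.factorial_succ]; ring
    · rw [← summable_nat_add_iff 1]
      simp_rw [low, displacementCoeff_lower]
      exact aux _ _ _ _ s1 h1.summable

/-- The single term m = k + α of the preceding series is at most its sum. -/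
lemma pow_mul_laguerre_sq_le (α k : ℕ) (t : ℝ) :
    t ^ (2 * α) * laguerre α k (t ^ 2) ^ 2 ≤
      ((k + α).factorial / k.factorial : ℝ) * Real.exp (t ^ 2) := by
  have h := (hasSum_displacementCoeff t k).1
  have h1 := le_hasSum h (k + α) fun m _ => by positivity
  rw [displacementCoeff_eq_laguerre] at h1
  have hk : (0 : ℝ) < k.factorial := by positivity
  have hka : (0 : ℝ) < (k + α).factorial := by positivity
  have h2 : ((k + α).factorial : ℝ) *
      (t ^ α * (k.factorial / (k + α).factorial : ℝ) * laguerre α k (t ^ 2)) ^ 2 =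
      (t ^ (2 * α) * laguerre α k (t ^ 2) ^ 2) * (k.factorial ^ 2 / (k + α).factorial : ℝ) := by
    field_simp
    ring
  rw [h2, ← le_div_iff₀ (by positivity)] at h1
  refine h1.trans (le_of_eq ?_)
  field_simp

lemma abs_laguerre_le (α k : ℕ) {x : ℝ} (hx : 0 ≤ x) :
    |laguerre α k x| ≤ ((k : ℝ) + 1) ^ α * Real.exp (x / 2) := by
  induction α generalizing k with
  | zero =>
    have h := pow_mul_laguerre_sq_le 0 k (√x)
    rw [Real.sq_sqrt hx] at h
    have hk : (k.factorial : ℝ) ≠ 0 := by positivity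
    simp only [mul_zero, pow_zero, one_mul, add_zero, div_self hk] at h ⊢
    refine abs_le_of_sq_le_sq (h.trans (le_of_eq ?_)) (by positivity)
    rw [← Real.exp_nat_mul]; congr 1; push_cast; ring
  | succ α ih =>
    induction k with
    | zero =>
      simp; positivity
    | succ k ih2 =>
      rw [laguerre_succ_succ]
      refine (abs_add_le _ _).trans ((add_le_add ih2 (ih (k + 1))).trans ?_)
      rw [← add_mul]
      gcongr
      push_cast
      have : ((k : ℝ) + 1) ^ (α + 1) ≤ (k + 1) * ((k : ℝ) + 1 + 1) ^ α := by
        rw [pow_succ, mul_comm]; gcongr; linarith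
      calc _ ≤ (k + 1) * ((k : ℝ) + 1 + 1) ^ α + ((k : ℝ) + 1 + 1) ^ α := by gcongr
        _ = _ := by ring

/-- The three-term recurrence trades each factor x for a factor linear in k. Polynomial growth in k
is all that the convergence of the Abel sums requires. -/
lemma pow_mul_abs_laguerre_le (α k n : ℕ) {x : ℝ} (hx : 0 ≤ x) :
    x ^ n * |laguerre α k x| ≤ 4 ^ n * ((k : ℝ) + α + n + 1) ^ (α + n) * Real.exp (x / 2) := by
  induction n generalizing k with
  | zero =>
    simp only [pow_zero, one_mul, Nat.cast_zero, add_zero]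
    refine (abs_laguerre_le α k hx).trans ?_
    gcongr
    linarith [(Nat.cast_nonneg α : (0 : ℝ) ≤ α)]
  | succ n ih =>
    set E := Real.exp (x / 2)
    set B : ℝ := 4 ^ n * ((k : ℝ) + α + n + 2) ^ (α + n) * E with hB
    have mono : ∀ j : ℕ, j ≤ k + 1 → x ^ n * |laguerre α j x| ≤ B := by
      intro j hj
      refine (ih j).trans ?_
      have : (j : ℝ) ≤ k + 1 := by exact_mod_cast hj
      rw [hB]
      gcongr ?_ * ?_ ^ _ * _
      linarith
    -- At k = 0 the index k - 1 truncates to 0 and the last term is only a nonnegative surplus.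
    have key : |x * laguerre α k x| ≤ (k + 1) * |laguerre α (k + 1) x|
        + (2 * k + α + 1) * |laguerre α k x| + (k + α) * |laguerre α (k - 1) x| := by
      cases k with
      | zero =>
        rw [mul_laguerre_zero]
        refine (abs_add_le _ _).trans ?_
        rw [abs_neg, abs_mul, abs_of_nonneg (by positivity : (0 : ℝ) ≤ α + 1)]
        simp
      | succ k =>
        rw [mul_laguerre]
        refine (abs_sub _ _).trans (add_le_add ((abs_add_le _ _).trans (add_le_add ?_ ?_)) ?_)
        · rw [abs_mul, abs_neg, abs_of_nonneg (by positivity)]; push_cast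
          apply le_of_eq; ring_nf
        · rw [abs_mul, abs_of_nonneg (by positivity)]; push_cast; rfl
        · rw [abs_mul, abs_of_nonneg (by positivity)]; push_cast; simp
    have hBB : x ^ (n + 1) * |laguerre α k x| ≤ (4 * k + 2 * α + 2) * B := by
      calc x ^ (n + 1) * |laguerre α k x| = x ^ n * |x * laguerre α k x| := by
            rw [abs_mul, abs_of_nonneg hx]; ring
        _ ≤ x ^ n * ((k + 1) * |laguerre α (k + 1) x|
            + (2 * k + α + 1) * |laguerre α k x| + (k + α) * |laguerre α (k - 1) x|) := by gcongr
        _ = (k + 1) * (x ^ n * |laguerre α (k + 1) x|) + (2 * k + α + 1) * (x ^ n * |laguerre α k x|)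
            + (k + α) * (x ^ n * |laguerre α (k - 1) x|) := by ring
        _ ≤ (k + 1) * B + (2 * k + α + 1) * B + (k + α) * B := by
            gcongr <;> exact mono _ (by omega)
        _ = _ := by ring
    refine hBB.trans ?_
    have hB0 : 0 ≤ B := by positivity
    calc (4 * k + 2 * α + 2) * B ≤ (4 * ((k : ℝ) + α + n + 2)) * B := by
          gcongr
          linarith [(Nat.cast_nonneg α : (0 : ℝ) ≤ α), (Nat.cast_nonneg n : (0 : ℝ) ≤ n)]
      _ = _ := by rw [hB]; push_cast; ring

/-! ### Generating function -/

/-- The generating function of the Laguerre polynomials. -/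
lemma hasSum_laguerre (α : ℕ) {r : ℝ} (hr0 : 0 ≤ r) (hr1 : r < 1) (x : ℝ) :
    HasSum (fun k => r ^ k * laguerre α k x)
      ((1 - r)⁻¹ ^ (α + 1) * Real.exp (-(x * (r / (1 - r))))) := by
  have hs : 0 < 1 - r := by linarith
  have hn : ‖r‖ < 1 := by rwa [Real.norm_of_nonneg hr0]
  -- At y = -x, summing over the second index and then the first gives the closed form, while
  -- grouping by i + m = k gives r^k L_k^α(x). Absolute convergence is read off at y = |x|.
  let F : ℝ → ℕ × ℕ → ℝ := fun y p =>
    (y * r) ^ p.1 / (p.1.factorial : ℝ) * (((p.2 + (α + p.1)).choose (α + p.1) : ℝ) * r ^ p.2)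
  have inner : ∀ y : ℝ, ∀ i, HasSum (fun m => F y (i, m))
      ((y * r) ^ i / (i.factorial : ℝ) * (1 / (1 - r) ^ (α + i + 1))) := fun y i =>
    (hasSum_choose_mul_geometric_of_norm_lt_one (α + i) hn).mul_left _
  have outer : ∀ y : ℝ, HasSum (fun i : ℕ =>
      (y * r) ^ i / (i.factorial : ℝ) * (1 / (1 - r) ^ (α + i + 1)))
      ((1 - r)⁻¹ ^ (α + 1) * Real.exp (y * (r / (1 - r)))) := by
    intro y
    have := (NormedSpace.expSeries_div_hasSum_exp (y * (r / (1 - r)))).mul_left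
      ((1 - r)⁻¹ ^ (α + 1))
    rw [← Real.exp_eq_exp_ℝ] at this
    convert! this using 1
    funext i
    rw [div_eq_mul_inv r, mul_pow y, mul_pow y, mul_pow r, one_div, ← inv_pow]
    ring
  have habs : Summable (F |x|) := by
    have hF0 : ∀ p, 0 ≤ F |x| p := fun p => by positivity
    rw [summable_prod_of_nonneg hF0]
    refine ⟨fun i => (inner _ i).summable, ?_⟩
    simp_rw [fun i => (inner |x| i).tsum_eq]
    exact (outer _).summable
  have hF : Summable (F (-x)) := by
    refine Summable.of_norm_bounded habs fun p => le_of_eq ?_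
    simp only [F, norm_mul, norm_div, norm_pow, norm_neg, Real.norm_natCast, Real.norm_eq_abs x,
      Real.norm_of_nonneg hr0]
  have h1 : HasSum (F (-x)) ((1 - r)⁻¹ ^ (α + 1) * Real.exp (-(x * (r / (1 - r))))) := by
    have h2 := hF.hasSum.prod_fiberwise (inner (-x))
    rw [show -(x * (r / (1 - r))) = -x * (r / (1 - r)) by ring, ← h2.unique (outer (-x))]
    exact hF.hasSum
  have h3 := (Finset.HasAntidiagonal.sigmaAntidiagonalEquivProd (A := ℕ)).hasSum_iff.2 h1
  have h4 := h3.sigma fun k => hasSum_fintype _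
  convert! h4 using 1
  funext k
  change _ = ∑ b : Finset.HasAntidiagonal.antidiagonal k, F (-x) b
  rw [Finset.univ_eq_attach, Finset.sum_attach (Finset.HasAntidiagonal.antidiagonal k) fun p => F (-x) p,
    Finset.Nat.sum_antidiagonal_eq_sum_range_succ_mk, laguerre, Finset.mul_sum]
  refine Finset.sum_congr rfl fun i hi => ?_
  have hik : i ≤ k := by rw [Finset.mem_range] at hi; omega
  simp only [F]
  rw [show k - i + (α + i) = k + α by omega]
  have : r ^ k = r ^ i * r ^ (k - i) := by rw [← pow_add]; congr 1; omega
  rw [this]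
  ring

/-! ### Multiplication by the variable and finite differences -/

/-- The action on Laguerre coefficients of multiplication by the variable. -/
noncomputable def mulVar (d : ℕ) (a : ℤ → ℂ) (k : ℤ) : ℂ :=
  k * (a k - a (k - 1)) - (k + d) * (a (k + 1) - a k)

/-- Summation by parts in the three-term recurrence; the two vanishing coefficients remove the upper
boundary terms. At the lower end a(-1) carries the factor k = 0. -/
lemma mul_sum_laguerre (α : ℕ) (a : ℤ → ℂ) (K : ℕ) (h1 : a K = 0) (h2 : a (K + 1) = 0) (x : ℝ) :
    (x : ℂ) * ∑ k ∈ Finset.range (K + 1), a k * (laguerre α k x : ℂ) =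
      ∑ k ∈ Finset.range (K + 1), mulVar (α + 1) a k * (laguerre α k x : ℂ) := by
  have key : ∀ n : ℕ, (x : ℂ) * ∑ k ∈ Finset.range (n + 1), a k * (laguerre α k x : ℂ) =
      ∑ k ∈ Finset.range (n + 1), mulVar (α + 1) a k * (laguerre α k x : ℂ)
      + (n + 1 + α) * a (n + 1) * (laguerre α n x : ℂ)
      - (n + 1) * a n * (laguerre α (n + 1) x : ℂ) := by
    intro n
    induction n with
    | zero =>
      have h := mul_laguerre_zero α x
      have hc : (x : ℂ) * (laguerre α 0 x : ℂ) =
        -(laguerre α 1 x : ℂ) + (α + 1) * (laguerre α 0 x : ℂ) := by exact_mod_cast h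
      simp [mulVar] at hc ⊢
      linear_combination a 0 * hc
    | succ n ih =>
      have h := mul_laguerre α n x
      have hc : (x : ℂ) * (laguerre α (n + 1) x : ℂ) = -(n + 2) * (laguerre α (n + 2) x : ℂ)
        + (2 * (n + 1) + α + 1) * (laguerre α (n + 1) x : ℂ)
        - (n + 1 + α) * (laguerre α n x : ℂ) := by exact_mod_cast h
      rw [Finset.sum_range_succ, Finset.sum_range_succ (n := n + 1), mul_add, ih]
      simp only [mulVar]
      push_cast
      rw [show (n : ℤ) + 1 - 1 = n by ring]
      linear_combination a (n + 1) * hc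
  rw [key K, h1, h2]
  simp

lemma fwdDiff_iter_succ (a : ℤ → ℂ) (j : ℕ) (k : ℤ) :
    (fwdDiff 1)^[j + 1] a k = (fwdDiff 1)^[j] a (k + 1) - (fwdDiff 1)^[j] a k := by
  rw [Function.iterate_succ_apply']; rfl

/-- For j = 0 this exhibits the gain: the factor k comes with two differences, the constant d with
one. Higher j is the discrete Leibniz rule. -/
lemma fwdDiff_iter_mulVar (d : ℕ) (a : ℤ → ℂ) (j : ℕ) (k : ℤ) :
    (fwdDiff 1)^[j] (mulVar d a) k = -(k * (fwdDiff 1)^[j + 2] a (k - 1))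
      - j * (fwdDiff 1)^[j + 1] a k - d * (fwdDiff 1)^[j + 1] a k := by
  induction j generalizing k with
  | zero =>
    simp only [Function.iterate_zero, id, mulVar, fwdDiff_iter_succ]
    rw [sub_add_cancel]; push_cast; ring
  | succ j ih =>
    have p := fwdDiff_iter_succ a (j + 1) k
    have q := fwdDiff_iter_succ a (j + 2) (k - 1)
    rw [sub_add_cancel] at q
    rw [fwdDiff_iter_succ, ih, ih, add_sub_cancel_right]
    push_cast
    linear_combination (j + d : ℂ) * p + k * q

lemma fwdDiff_iter_eq_zero {a : ℤ → ℂ} {X : ℝ} (ha : ∀ k : ℤ, X < |(k : ℝ)| → a k = 0) (j : ℕ)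
    {k : ℤ} (hk : X + j < |(k : ℝ)|) : (fwdDiff 1)^[j] a k = 0 := by
  induction j generalizing k with
  | zero => exact ha k (by simpa using hk)
  | succ j ih =>
    push_cast at hk
    have := abs_sub_abs_le_abs_add (k : ℝ) 1
    rw [abs_one] at this
    have h1 : X + j < |((k + 1 : ℤ) : ℝ)| := by push_cast; linarith
    rw [fwdDiff_iter_succ, ih h1, ih (k := k) (by linarith), sub_zero]

lemma mulVar_eq_zero {d : ℕ} {a : ℤ → ℂ} {P : ℤ → Prop}
    (ha : ∀ k, P k → a k = 0) {k : ℤ} (h0 : P k) (h1 : P (k - 1)) (h2 : P (k + 1)) :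
    mulVar d a k = 0 := by
  simp [mulVar, ha _ h0, ha _ h1, ha _ h2]

/-- Near the support k Δ² costs about Xρ⁻², and Δ costs ρ⁻¹ ≤ Xρ⁻² because ρ ≤ X. Each application
thus costs X/ρ² and consumes two differences. -/
lemma norm_mulVar_iter_le (d n : ℕ) : ∃ C : ℝ, 0 < C ∧ ∀ (a : ℤ → ℂ) (X ρ B : ℝ), 1 ≤ ρ → ρ ≤ X →
    0 ≤ B → (∀ k : ℤ, X < |(k : ℝ)| → a k = 0) →
    (∀ j ≤ 2 * n, ∀ k, ‖(fwdDiff 1)^[j] a k‖ ≤ B * (ρ⁻¹) ^ j) →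
    ∀ k, ‖(mulVar d)^[n] a k‖ ≤ C * B * (X / ρ ^ 2) ^ n := by
  induction n with
  | zero =>
    refine ⟨1, one_pos, fun a X ρ B _ _ _ _ h k => ?_⟩
    simpa using h 0 le_rfl k
  | succ n ih =>
    obtain ⟨C, hC, h⟩ := ih
    -- 4n + 4 + d bounds the 2j + 4 + d found below for j ≤ 2n; 2^n pays for the support growing to
    -- X + 1 ≤ 2X.
    refine ⟨C * (4 * n + 4 + d) * 2 ^ n, by positivity, fun a X ρ B hρ hX hB ha hD k => ?_⟩
    have hρ0 : 0 < ρ := by linarith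
    have hX0 : 0 < X := by linarith
    rw [Function.iterate_succ_apply]
    have h1 := h (mulVar d a) (X + 1) ρ ((4 * n + 4 + d) * B * (X / ρ ^ 2)) hρ (by linarith)
      (by positivity) ?_ ?_ k
    · refine h1.trans ?_
      calc C * ((4 * n + 4 + d) * B * (X / ρ ^ 2)) * ((X + 1) / ρ ^ 2) ^ n
          ≤ C * ((4 * n + 4 + d) * B * (X / ρ ^ 2)) * ((2 * X) / ρ ^ 2) ^ n := by
            gcongr; linarith
        _ = _ := by rw [mul_div_assoc, mul_pow]; ring
    · intro k hk
      have hm := abs_sub_abs_le_abs_sub (k : ℝ) 1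
      have hp := abs_sub_abs_le_abs_add (k : ℝ) 1
      rw [abs_one] at hm hp
      refine mulVar_eq_zero (P := fun k : ℤ => X < |(k : ℝ)|) ha (by linarith) ?_ ?_ <;> push_cast <;>
        linarith
    · intro j hj k
      rw [fwdDiff_iter_mulVar]
      have e1 : ‖(k : ℂ) * (fwdDiff 1)^[j + 2] a (k - 1)‖ ≤ (X + j + 3) * (B * (ρ⁻¹) ^ (j + 2)) := by
        rcases le_or_gt |(k : ℝ)| (X + j + 3) with hk | hk
        · rw [norm_mul, Complex.norm_intCast]
          exact mul_le_mul hk (hD _ (by omega) _) (norm_nonneg _) (by positivity)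
        · rw [fwdDiff_iter_eq_zero ha, mul_zero, norm_zero]
          · positivity
          · push_cast
            have hm := abs_sub_abs_le_abs_sub (k : ℝ) 1
            rw [abs_one] at hm
            linarith
      have e2 : ∀ m : ℕ, ‖(m : ℂ) * (fwdDiff 1)^[j + 1] a k‖ ≤ m * (B * (ρ⁻¹) ^ (j + 1)) := by
        intro m
        rw [norm_mul, Complex.norm_natCast]
        gcongr
        exact hD _ (by omega) _
      have e3 : B * (ρ⁻¹) ^ (j + 1) ≤ X * (B * (ρ⁻¹) ^ (j + 2)) := by
        rw [pow_succ _ (j + 1)]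
        have : 1 ≤ X * ρ⁻¹ := by
          rw [← div_eq_mul_inv, one_le_div hρ0]; exact hX
        calc B * (ρ⁻¹) ^ (j + 1) = B * (ρ⁻¹) ^ (j + 1) * 1 := by ring
          _ ≤ B * (ρ⁻¹) ^ (j + 1) * (X * ρ⁻¹) := by gcongr
          _ = _ := by ring
      have e4 : (X + j + 3) * (B * (ρ⁻¹) ^ (j + 2)) ≤ (j + 4) * (X * (B * (ρ⁻¹) ^ (j + 2))) := by
        rw [← mul_assoc ((j : ℝ) + 4)]
        refine mul_le_mul_of_nonneg_right ?_ (by positivity)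
        nlinarith [(Nat.cast_nonneg j : (0 : ℝ) ≤ j)]
      have hj' : (j : ℝ) ≤ 2 * n := by exact_mod_cast hj
      calc _ ≤ ‖(k : ℂ) * (fwdDiff 1)^[j + 2] a (k - 1)‖ + ‖(j : ℂ) * (fwdDiff 1)^[j + 1] a k‖
            + ‖(d : ℂ) * (fwdDiff 1)^[j + 1] a k‖ := by
            refine (norm_sub_le _ _).trans (add_le_add_left ((norm_sub_le _ _).trans ?_) _)
            rw [norm_neg]
        _ ≤ (j + 4) * (X * (B * (ρ⁻¹) ^ (j + 2))) + j * (X * (B * (ρ⁻¹) ^ (j + 2)))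
            + d * (X * (B * (ρ⁻¹) ^ (j + 2))) := by
            refine add_le_add (add_le_add (e1.trans e4) ((e2 j).trans ?_)) ((e2 d).trans ?_) <;>
              gcongr
        _ = (2 * j + 4 + d) * (X * (B * (ρ⁻¹) ^ (j + 2))) := by ring
        _ ≤ (4 * n + 4 + d) * (X * (B * (ρ⁻¹) ^ (j + 2))) := by
            refine mul_le_mul_of_nonneg_right ?_ (by positivity)
            linarith
        _ = _ := by rw [pow_add]; field_simp

/-- Each unit difference is absorbed by the mean value inequality for a derivative. -/
lemma norm_fwdDiff_iter_le_of_deriv {h : ℝ → ℂ} (hh : ContDiff ℝ ∞ h) (j : ℕ) {B : ℝ}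
    (hB : ∀ s, ‖iteratedDeriv j h s‖ ≤ B) (s : ℝ) : ‖(fwdDiff 1)^[j] h s‖ ≤ B := by
  induction j generalizing h s with
  | zero => simpa using hB s
  | succ j ih =>
    rw [Function.iterate_succ_apply]
    have hs : ContDiff ℝ ∞ (fun x => h (x + 1)) := hh.comp (contDiff_id.add contDiff_const)
    refine ih (h := fwdDiff 1 h) (hs.sub hh) (fun s => ?_) s
    have e : iteratedDeriv j (fwdDiff 1 h) s = iteratedDeriv j h (s + 1) - iteratedDeriv j h s := by
      change iteratedDeriv j (fun x => h (x + 1) - h x) s = _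
      rw [iteratedDeriv_fun_sub (hs.contDiffAt.of_le (by exact_mod_cast le_top))
        (hh.contDiffAt.of_le (by exact_mod_cast le_top)), iteratedDeriv_comp_add_const]
    rw [e]
    have hdiff : Differentiable ℝ (iteratedDeriv j h) :=
      hh.differentiable_iteratedDeriv j (by exact_mod_cast WithTop.coe_lt_top _)
    have := Convex.norm_image_sub_le_of_norm_deriv_le (f := iteratedDeriv j h) (C := B)
      (s := Set.univ) (x := s) (y := s + 1) (fun x _ => hdiff x)
      (fun x _ => by rw [← iteratedDeriv_succ]; exact hB x) convex_univ trivial trivial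
    simpa using this

lemma norm_fwdDiff_iter_le (a : ℤ → ℂ) {A : ℝ} (ha : ∀ k, ‖a k‖ ≤ A) (j : ℕ) (k : ℤ) :
    ‖(fwdDiff 1)^[j] a k‖ ≤ 2 ^ j * A := by
  induction j generalizing k with
  | zero => simpa using ha k
  | succ j ih =>
    rw [fwdDiff_iter_succ, pow_succ]
    refine (norm_sub_le _ _).trans ?_
    linarith [ih k, ih (k + 1)]

lemma fwdDiff_iter_intCast (h : ℝ → ℂ) (j : ℕ) (k : ℤ) :
    (fwdDiff 1)^[j] (fun k : ℤ => h k) k = (fwdDiff 1)^[j] h k := by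
  induction j generalizing k with
  | zero => rfl
  | succ j ih =>
    rw [fwdDiff_iter_succ, ih, ih, Function.iterate_succ_apply']
    push_cast; rfl

/-- The difference bounds for the Laguerre coefficients of a spectral multiplier. -/
lemma norm_fwdDiff_iter_multiplier_le {η : ℝ → ℂ} (hη : ContDiff ℝ ∞ η) {A : ℝ} {M : ℕ}
    (hA : ∀ k ≤ M, ∀ s, ‖iteratedDeriv k η s‖ ≤ A) (μ e R : ℝ) (hR : 0 < R) {j : ℕ} (hj : j ≤ M)
    (k : ℤ) :
    ‖(fwdDiff 1)^[j] (fun k : ℤ => η ((μ - (e + 2 * k)) / R)) k‖ ≤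
      2 ^ M * A * ((max 1 R)⁻¹) ^ j := by
  have hA0 : 0 ≤ A := (norm_nonneg _).trans (hA 0 (Nat.zero_le _) 0)
  have h2 : (2 : ℝ) ^ j ≤ 2 ^ M := pow_le_pow_right₀ one_le_two hj
  -- For R ≤ 1 smoothness is invisible at unit steps and the triangle inequality suffices. For R ≥ 1
  -- a unit step in k moves the argument of η by 2/R, so j differences gain (2/R)^j.
  rcases le_total R 1 with h | h
  · rw [max_eq_left h, inv_one, one_pow, mul_one]
    refine (norm_fwdDiff_iter_le _ (fun k => ?_) j k).trans (by gcongr)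
    simpa using hA 0 (Nat.zero_le _) ((μ - (e + 2 * k)) / R)
  · rw [max_eq_right h]
    let g : ℝ → ℂ := fun s => η ((-2 / R) * s + (μ - e) / R)
    have hg : (fun k : ℤ => η ((μ - (e + 2 * k)) / R)) = fun k : ℤ => g k := by
      funext k; simp only [g]; congr 1; field_simp; ring
    rw [hg, fwdDiff_iter_intCast g]
    have hsm : ContDiff ℝ ∞ (fun x : ℝ => η (x + (μ - e) / R)) :=
      hη.comp (contDiff_id.add contDiff_const)
    refine norm_fwdDiff_iter_le_of_deriv (h := g) (hη.comp ((contDiff_const.mul contDiff_id).add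
      contDiff_const)) j (fun s => ?_) _
    have : iteratedDeriv j g = fun s => (-2 / R) ^ j • iteratedDeriv j η ((-2 / R) * s + (μ - e) / R) := by
      have := iteratedDeriv_comp_const_smul (n := j) (f := fun x : ℝ => η (x + (μ - e) / R))
        (hsm.of_le (by exact_mod_cast le_top)) (-2 / R)
      simp only [iteratedDeriv_comp_add_const] at this
      exact this
    rw [this, norm_smul, norm_pow, norm_div, norm_neg, Real.norm_of_nonneg hR.le,
      Real.norm_of_nonneg zero_le_two, div_pow, inv_pow]
    calc _ ≤ 2 ^ j / R ^ j * A := by gcongr; exact hA j hj _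
      _ ≤ 2 ^ M / R ^ j * A := by gcongr
      _ = _ := by ring

/-- The n extra indices leave room for the support to grow by one at each multiplication. -/
lemma pow_mul_sum_laguerre (α n : ℕ) (a : ℤ → ℂ) (K : ℕ) (ha : ∀ k : ℤ, K ≤ k → a k = 0) (x : ℝ) :
    (x : ℂ) ^ n * ∑ k ∈ Finset.range (K + n + 1), a k * (laguerre α k x : ℂ) =
      ∑ k ∈ Finset.range (K + n + 1), (mulVar (α + 1))^[n] a k * (laguerre α k x : ℂ) := by
  induction n generalizing a K with
  | zero => simp
  | succ n ih =>
    have h := mul_sum_laguerre α a (K + n + 1) (ha _ (by push_cast; omega)) (ha _ (by push_cast; omega)) x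
    have h2 := ih (mulVar (α + 1) a) (K + 1) fun k hk => by
      push_cast at hk
      exact mulVar_eq_zero (P := fun k : ℤ => (K : ℤ) ≤ k) ha (by omega) (by omega) (by omega)
    rw [show K + 1 + n + 1 = K + n + 1 + 1 by ring] at h2
    rw [show K + (n + 1) + 1 = K + n + 1 + 1 by ring, pow_succ, mul_assoc, h, h2,
      Function.iterate_succ_apply]

/-- Each application reads only the neighbouring indices, which shifts 2k by 2. The number of
nonzero coefficients thus stays of order R + n. -/
lemma mulVar_iter_eq_zero {d : ℕ} {a : ℤ → ℂ} {e r : ℝ}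
    (ha : ∀ k : ℤ, r ≤ |e - 2 * k| → a k = 0) (n : ℕ) {k : ℤ} (hk : r + 2 * n ≤ |e - 2 * (k : ℝ)|) :
    (mulVar d)^[n] a k = 0 := by
  induction n generalizing k with
  | zero => exact ha k (by simpa using hk)
  | succ n ih =>
    rw [Function.iterate_succ_apply']
    push_cast at hk
    refine mulVar_eq_zero (P := fun k : ℤ => r + 2 * n ≤ |e - 2 * (k : ℝ)|) (fun k hk => ih hk)
      (by linarith) ?_ ?_
    · have := abs_sub_abs_le_abs_add (e - 2 * (k : ℝ)) 2
      rw [abs_two] at this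
      push_cast
      rw [show e - 2 * ((k : ℝ) - 1) = e - 2 * k + 2 by ring]
      linarith
    · have := abs_sub_abs_le_abs_sub (e - 2 * (k : ℝ)) 2
      rw [abs_two] at this
      push_cast
      rw [show e - 2 * ((k : ℝ) + 1) = e - 2 * k - 2 by ring]
      linarith

lemma card_filter_abs_lt_le (K : ℕ) (e r : ℝ) (hr : 0 ≤ r) :
    (((Finset.range K).filter fun k : ℕ => |e - 2 * (k : ℝ)| < 2 * r).card : ℝ) ≤ 2 * r + 1 := by
  have h1 : ((Finset.range K).filter fun k : ℕ => |e - 2 * (k : ℝ)| < 2 * r).card ≤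
      (Finset.Icc ⌈e / 2 - r⌉ ⌊e / 2 + r⌋).card := by
    refine Finset.card_le_card_of_injOn (fun k : ℕ => (k : ℤ)) (fun k hk => ?_)
      (fun a _ b _ h => by simpa using h)
    simp only [Finset.coe_filter, Finset.mem_range, Set.mem_ofPred_eq, abs_lt] at hk
    simp only [Finset.coe_Icc, Set.mem_Icc, Int.ceil_le, Int.le_floor, Int.cast_natCast]
    constructor <;> linarith [hk.2.1, hk.2.2]
  rw [Int.card_Icc] at h1
  have h2 := Int.floor_le (e / 2 + r)
  have h3 := Int.le_ceil (e / 2 - r)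
  have h4 : (((⌊e / 2 + r⌋ + 1 - ⌈e / 2 - r⌉).toNat : ℤ) : ℝ) ≤ 2 * r + 1 := by
    rcases le_total 0 (⌊e / 2 + r⌋ + 1 - ⌈e / 2 - r⌉) with h | h
    · rw [Int.toNat_of_nonneg h]; push_cast; linarith
    · rw [Int.toNat_of_nonpos h]; simp; linarith
  calc _ ≤ (((⌊e / 2 + r⌋ + 1 - ⌈e / 2 - r⌉).toNat : ℕ) : ℝ) := by exact_mod_cast h1
    _ ≤ _ := by exact_mod_cast h4

/-! ### The off-diagonal estimate for Laguerre sums -/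

/-- The unitarity bound at t = s/√2, with (k + α)!/k! ≤ (k + α)^α. Keeping s^α on the left leaves
growth k^{α/2} instead of the k^α of `abs_laguerre_le`; this makes the final power ρ^{α+1}. -/
lemma pow_mul_abs_laguerre_mul_exp_le (α k : ℕ) {s Q : ℝ} (hQ : 2 * ((k : ℝ) + α) ≤ Q) :
    s ^ α * (|laguerre α k (s ^ 2 / 2)| * Real.exp (-(s ^ 2 / 4))) ≤ √Q ^ α := by
  have hQ0 : 0 ≤ Q := le_trans (by positivity) hQ
  have h := pow_mul_laguerre_sq_le α k (s / √2)
  rw [div_pow, div_pow, Real.sq_sqrt zero_le_two, pow_mul (√2), Real.sq_sqrt zero_le_two] at h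
  have hfac : ((k + α).factorial / k.factorial : ℝ) ≤ ((k : ℝ) + α) ^ α := by
    rw [div_le_iff₀ (by positivity)]
    have : (k + α).factorial ≤ k.factorial * (k + α) ^ α := by
      rw [← Nat.factorial_mul_ascFactorial]
      exact Nat.mul_le_mul_left _ (Nat.ascFactorial_le_pow_add k α)
    calc ((k + α).factorial : ℝ) ≤ ((k.factorial * (k + α) ^ α : ℕ) : ℝ) := by exact_mod_cast this
      _ = _ := by push_cast; ring
  refine abs_le_of_sq_le_sq' ?_ (by positivity) |>.2
  have e1 : Real.exp (-(s ^ 2 / 4)) ^ 2 = (Real.exp (s ^ 2 / 2))⁻¹ := by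
    rw [← Real.exp_neg, ← Real.exp_nat_mul]; congr 1; push_cast; ring
  rw [← pow_mul, mul_comm α 2, pow_mul (√Q), Real.sq_sqrt hQ0, mul_pow, mul_pow, sq_abs, e1,
    ← pow_mul, mul_comm α 2, ← mul_assoc, ← div_eq_mul_inv, div_le_iff₀ (Real.exp_pos _)]
  calc s ^ (2 * α) * laguerre α k (s ^ 2 / 2) ^ 2
      = 2 ^ α * (s ^ (2 * α) / 2 ^ α * laguerre α k (s ^ 2 / 2) ^ 2) := by field_simp
    _ ≤ 2 ^ α * (((k : ℝ) + α) ^ α * Real.exp (s ^ 2 / 2)) := by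
        refine mul_le_mul_of_nonneg_left (h.trans ?_) (by positivity)
        exact mul_le_mul_of_nonneg_right hfac (Real.exp_pos _).le
    _ = (2 * ((k : ℝ) + α)) ^ α * Real.exp (s ^ 2 / 2) := by rw [mul_pow]; ring
    _ ≤ _ := by gcongr

lemma exists_norm_sum_laguerre_le (α : ℕ) (N c : ℝ) (hc : 0 < c) :
    ∃ (M : ℕ) (C : ℝ), 0 < C ∧ ∀ η : ℝ → ℂ, ContDiff ℝ ∞ η → tsupport η ⊆ Set.Ioo (-2) 2 →
      ∀ A : ℝ, (∀ k ≤ M, ∀ s : ℝ, ‖iteratedDeriv k η s‖ ≤ A) →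
      ∀ μ R : ℝ, 1 ≤ μ → 0 < R → ∀ K : ℕ,
      (∀ k : ℤ, K ≤ k → η ((μ - ((α : ℝ) + 1 + 2 * k)) / R) = 0) → ∀ ρ κ s : ℝ,
      ρ = max 1 R → κ = max μ ρ → c * (√κ / ρ) ≤ s →
      ‖∑ k ∈ Finset.range K, η ((μ - ((α : ℝ) + 1 + 2 * k)) / R) * (laguerre α k (s ^ 2 / 2) : ℂ)‖
        * Real.exp (-(s ^ 2 / 4)) ≤ C * A * ρ ^ (α + 1) * (1 + ρ / √κ * s) ^ (-N) := by
  set n : ℕ := ⌈N⌉₊ with hn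
  obtain ⟨C₁, hC₁, hT⟩ := norm_mulVar_iter_le (α + 1) n
  set Q : ℝ := 2 * (n + 2 + α) with hQdef
  have hQ0 : 0 < Q := by positivity
  -- n multiplications by s²/2 use 2n differences. In the constant, (2n + 3)ρ bounds the number of
  -- indices, C₁ 2^{2n} and (α + 3)^n come from the coefficients, 2^n from s²/2, (√Q/c)^α from the
  -- Laguerre functions, and the last factor from replacing y by 1 + y.
  refine ⟨2 * n, (2 * n + 3) * (C₁ * 2 ^ (2 * n)) * (2 * (α + 3)) ^ n * (√Q / c) ^ α *
    (1 + 1 / c) ^ (2 * n), by positivity, ?_⟩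
  intro η hη hsupp A hA μ R hμ hR K hK ρ κ s hρ hκ hs
  have hA0 : 0 ≤ A := (norm_nonneg _).trans (hA 0 (Nat.zero_le _) 0)
  have hρ1 : 1 ≤ ρ := hρ ▸ le_max_left _ _
  have hRρ : R ≤ ρ := hρ ▸ le_max_right _ _
  have hμκ : μ ≤ κ := hκ ▸ le_max_left _ _
  have hρκ : ρ ≤ κ := hκ ▸ le_max_right _ _
  have hρ0 : 0 < ρ := by linarith
  have hκ0 : 0 < κ := by linarith
  have hsκ : 0 < √κ := Real.sqrt_pos.2 hκ0
  have hs0 : 0 < s := lt_of_lt_of_le (by positivity) hs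
  have hα0 : (0 : ℝ) ≤ α := Nat.cast_nonneg α
  have hn0 : (0 : ℝ) ≤ n := Nat.cast_nonneg n
  set a : ℤ → ℂ := fun k => η ((μ - ((α : ℝ) + 1 + 2 * k)) / R) with ha
  have haz : ∀ k : ℤ, 2 * R ≤ |μ - (α + 1) - 2 * (k : ℝ)| → a k = 0 := by
    intro k hk
    by_contra h
    have h1 := hsupp (subset_tsupport _ (Function.mem_support.2 h))
    rw [Set.mem_Ioo, ← abs_lt, abs_div, abs_of_pos hR, div_lt_iff₀ hR] at h1
    rw [show μ - ((α : ℝ) + 1 + 2 * k) = μ - (α + 1) - 2 * (k : ℝ) by ring] at h1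
    linarith
  have haX : ∀ k : ℤ, (α + 3) * κ < |(k : ℝ)| → a k = 0 := by
    intro k hk
    refine haz k ?_
    have h1 := abs_sub_abs_le_abs_sub (2 * (k : ℝ)) (μ - (α + 1))
    rw [abs_sub_comm (2 * (k : ℝ)), abs_mul, abs_two] at h1
    have h2 : |μ - (α + 1)| ≤ μ + (α + 1) := by rw [abs_le]; constructor <;> linarith
    have : (α : ℝ) + 1 ≤ (α + 1) * κ := by nlinarith
    nlinarith
  have hb := hT a ((α + 3) * κ) ρ (2 ^ (2 * n) * A) hρ1 (by nlinarith) (by positivity) haX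
    fun j hj k => by rw [hρ]; exact norm_fwdDiff_iter_multiplier_le hη hA μ (α + 1) R hR hj k
  set b := (mulVar (α + 1))^[n] a with hbdef
  set B := C₁ * (2 ^ (2 * n) * A) * ((α + 3) * κ / ρ ^ 2) ^ n with hB
  set E := Real.exp (-(s ^ 2 / 4)) with hE
  set G := (√Q * ρ / c) ^ α with hG
  have hext : ∑ k ∈ Finset.range K, a k * (laguerre α k (s ^ 2 / 2) : ℂ) =
      ∑ k ∈ Finset.range (K + n + 1), a k * (laguerre α k (s ^ 2 / 2) : ℂ) := by
    refine Finset.sum_subset (Finset.range_subset_range.2 (by omega)) fun k _ hk => ?_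
    rw [Finset.mem_range, not_lt] at hk
    have : a k = 0 := hK k (by exact_mod_cast hk)
    rw [this, zero_mul]
  have hterm : ∀ k : ℕ, |μ - (α + 1) - 2 * (k : ℝ)| < 2 * (R + n) →
      |laguerre α k (s ^ 2 / 2)| * E ≤ G := by
    intro k hk
    rw [abs_lt] at hk
    have hkQ : 2 * ((k : ℝ) + α) ≤ Q * κ := by
      have : (n : ℝ) + α ≤ (n + α) * κ := by nlinarith
      nlinarith [hk.1]
    have h := pow_mul_abs_laguerre_mul_exp_le α k (s := s) hkQ
    -- The lower bound on s enters here: √κ ≤ sρ/c.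
    have h2 : √(Q * κ) ^ α ≤ s ^ α * G := by
      rw [hG, ← mul_pow, Real.sqrt_mul hQ0.le]
      refine pow_le_pow_left₀ (by positivity) ?_ _
      rw [mul_div_assoc', le_div_iff₀ hc]
      have : c * √κ ≤ s * ρ := by rwa [← mul_div_assoc, div_le_iff₀ hρ0] at hs
      nlinarith [Real.sqrt_nonneg Q]
    exact le_of_mul_le_mul_left (h.trans h2) (by positivity)
  have hsum : ‖∑ k ∈ Finset.range (K + n + 1), b k * (laguerre α k (s ^ 2 / 2) : ℂ)‖ * E ≤
      (2 * n + 3) * ρ * (B * G) := by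
    set S := (Finset.range (K + n + 1)).filter fun k : ℕ =>
      |μ - (α + 1) - 2 * (k : ℝ)| < 2 * (R + n) with hS
    have h1 : ∑ k ∈ Finset.range (K + n + 1), b k * (laguerre α k (s ^ 2 / 2) : ℂ) =
        ∑ k ∈ S, b k * (laguerre α k (s ^ 2 / 2) : ℂ) := by
      symm
      refine Finset.sum_subset (Finset.filter_subset _ _) fun k hk hk' => ?_
      have h2 : 2 * R + 2 * n ≤ |μ - (α + 1) - 2 * ((k : ℤ) : ℝ)| := by
        by_contra h
        refine hk' (Finset.mem_filter.2 ⟨hk, ?_⟩)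
        rw [not_le] at h
        push_cast at h
        linarith
      rw [hbdef, mulVar_iter_eq_zero haz n h2, zero_mul]
    rw [h1]
    calc _ ≤ (∑ k ∈ S, ‖b k * (laguerre α k (s ^ 2 / 2) : ℂ)‖) * E := by
          gcongr; exact norm_sum_le _ _
      _ = ∑ k ∈ S, ‖b k‖ * (|laguerre α k (s ^ 2 / 2)| * E) := by
          rw [Finset.sum_mul]
          refine Finset.sum_congr rfl fun k _ => ?_
          rw [norm_mul, Complex.norm_real, Real.norm_eq_abs, mul_assoc]
      _ ≤ ∑ k ∈ S, B * G := by
          refine Finset.sum_le_sum fun k hk => ?_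
          exact mul_le_mul (hb k) (hterm k (Finset.mem_filter.1 hk).2) (by positivity)
            (by positivity)
      _ = S.card * (B * G) := by rw [Finset.sum_const, nsmul_eq_mul]
      _ ≤ (2 * (R + n) + 1) * (B * G) := by
          gcongr; exact card_filter_abs_lt_le _ _ _ (by positivity)
      _ ≤ (2 * n + 3) * ρ * (B * G) := by
          refine mul_le_mul_of_nonneg_right ?_ (by positivity)
          nlinarith
  set F := ‖∑ k ∈ Finset.range K, a k * (laguerre α k (s ^ 2 / 2) : ℂ)‖ * E with hF
  have hmain : (s ^ 2 / 2) ^ n * F ≤ (2 * n + 3) * ρ * (B * G) := by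
    refine le_trans (le_of_eq ?_) hsum
    rw [hbdef, ← pow_mul_sum_laguerre α n a K hK, norm_mul, norm_pow, Complex.norm_real,
      Real.norm_of_nonneg (by positivity), hF, hext, mul_assoc]
  set y := ρ / √κ * s with hy
  have hy0 : 0 < y := by positivity
  have hyc : c ≤ y := by
    calc c = ρ / √κ * (c * (√κ / ρ)) := by field_simp
      _ ≤ y := by rw [hy]; gcongr
  have hy2 : y ^ 2 = ρ ^ 2 / κ * s ^ 2 := by
    rw [hy, mul_pow, div_pow, Real.sq_sqrt hκ0.le]
  -- Since y ≥ c, 1 + y ≤ (1 + 1/c) y.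
  have h1 : (1 + y) ^ (2 * n) ≤ (1 + 1 / c) ^ (2 * n) * y ^ (2 * n) := by
    rw [← mul_pow]
    gcongr
    have : 1 ≤ y / c := (one_le_div hc).2 hyc
    calc 1 + y ≤ y / c + y := by linarith
      _ = _ := by ring
  have h2 : y ^ (2 * n) * F ≤ (2 * n + 3) * (C₁ * 2 ^ (2 * n)) * (2 * (α + 3)) ^ n *
      (√Q / c) ^ α * A * ρ ^ (α + 1) := by
    calc y ^ (2 * n) * F = (2 * ρ ^ 2 / κ) ^ n * ((s ^ 2 / 2) ^ n * F) := by
          rw [pow_mul, hy2, show ρ ^ 2 / κ * s ^ 2 = 2 * ρ ^ 2 / κ * (s ^ 2 / 2) by ring,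
            mul_pow (2 * ρ ^ 2 / κ), mul_assoc]
      _ ≤ (2 * ρ ^ 2 / κ) ^ n * ((2 * n + 3) * ρ * (B * G)) := by gcongr
      _ = (2 * n + 3) * (C₁ * 2 ^ (2 * n)) * ((2 * ρ ^ 2 / κ) ^ n * ((α + 3) * κ / ρ ^ 2) ^ n) *
          G * A * ρ := by rw [hB]; ring
      _ = _ := by
          rw [← mul_pow, hG, show 2 * ρ ^ 2 / κ * ((α + 3) * κ / ρ ^ 2) = 2 * ((α : ℝ) + 3) by
            field_simp, mul_div_right_comm, mul_pow _ ρ]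
          ring
  have h3 : (1 + y) ^ (2 * n) * F ≤ (2 * n + 3) * (C₁ * 2 ^ (2 * n)) * (2 * (α + 3)) ^ n *
      (√Q / c) ^ α * (1 + 1 / c) ^ (2 * n) * A * ρ ^ (α + 1) := by
    calc _ ≤ (1 + 1 / c) ^ (2 * n) * y ^ (2 * n) * F := by gcongr
      _ = (1 + 1 / c) ^ (2 * n) * (y ^ (2 * n) * F) := by ring
      _ ≤ (1 + 1 / c) ^ (2 * n) * ((2 * n + 3) * (C₁ * 2 ^ (2 * n)) * (2 * (α + 3)) ^ n *
      (√Q / c) ^ α * A * ρ ^ (α + 1)) := by gcongr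
      _ = _ := by ring
  have h4 : (1 + y) ^ N ≤ (1 + y) ^ (2 * n) := by
    rw [← Real.rpow_natCast]
    refine Real.rpow_le_rpow_of_exponent_le (by linarith) ?_
    push_cast
    linarith [Nat.le_ceil N]
  rw [Real.rpow_neg (by positivity), ← div_eq_mul_inv, le_div_iff₀ (by positivity)]
  calc F * (1 + y) ^ N ≤ F * (1 + y) ^ (2 * n) := by gcongr
    _ = (1 + y) ^ (2 * n) * F := by ring
    _ ≤ _ := h3

/-! ### The Gaussian as a Schwartz function -/

lemma one_add_pow_mul_exp_le (m : ℕ) {t : ℝ} (ht : 0 ≤ t) :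
    (1 + t) ^ m * Real.exp (-(t ^ 2 / 4)) ≤ m.factorial * Real.exp 2 := by
  have h := Real.pow_div_factorial_le_exp (1 + t) (by positivity) m
  rw [div_le_iff₀ (by positivity)] at h
  calc _ ≤ Real.exp (1 + t) * m.factorial * Real.exp (-(t ^ 2 / 4)) := by gcongr
    _ = m.factorial * Real.exp (1 + t - t ^ 2 / 4) := by
      rw [mul_comm (Real.exp _), mul_assoc, ← Real.exp_add]; rfl
    _ ≤ _ := by
      gcongr
      nlinarith [sq_nonneg (t - 2)]

lemma exists_schwartz_gaussian (d : ℕ) :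
    ∃ ψ : 𝓢(Cn d, ℝ), ∀ w, ψ w = Real.exp (-(‖w‖ ^ 2 / 4)) := by
  let f : Cn d → ℝ := fun w => (-1 / 4) * ‖w‖ ^ 2
  have hsq : Function.HasTemperateGrowth (fun w : Cn d => ‖w‖ ^ 2) :=
    Function.hasTemperateGrowth_norm_sq (Cn d)
  have hf : Function.HasTemperateGrowth f := (Function.HasTemperateGrowth.const _).mul hsq
  have hcd : ContDiff ℝ ∞ (Real.exp ∘ f) := Real.contDiff_exp.comp hf.1
  refine ⟨⟨Real.exp ∘ f, hcd, fun p n => ?_⟩, fun w => ?_⟩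
  · obtain ⟨k, C, hC, hb⟩ := hf.norm_iteratedFDeriv_le_uniform n
    refine ⟨n.factorial * (C + 1) ^ n * ((k * n + p).factorial * Real.exp 2), fun x => ?_⟩
    have hD : ‖iteratedFDeriv ℝ n (Real.exp ∘ f) x‖ ≤
        n.factorial * Real.exp (f x) * ((C + 1) * (1 + ‖x‖) ^ k) ^ n := by
      refine norm_iteratedFDeriv_comp_le (N := ∞) Real.contDiff_exp hf.1 (by exact_mod_cast le_top)
        x (fun i _ => ?_) fun i hi hin => ?_
      · rw [norm_iteratedFDeriv_eq_norm_iteratedDeriv, iteratedDeriv_eq_iterate, Real.iter_deriv_exp,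
          Real.norm_of_nonneg (Real.exp_pos _).le]
      -- With C + 1 in place of C the base is at least 1, so it is dominated by its i-th power, as
      -- the Faà di Bruno bound requires.
      · have h1 : 1 ≤ (1 + ‖x‖) ^ k := one_le_pow₀ (by linarith [norm_nonneg x])
        calc _ ≤ C * (1 + ‖x‖) ^ k := hb i hin x
          _ ≤ (C + 1) * (1 + ‖x‖) ^ k := by gcongr; linarith
          _ ≤ _ := le_self_pow₀ (by nlinarith) (by omega)
    calc ‖x‖ ^ p * ‖iteratedFDeriv ℝ n (Real.exp ∘ f) x‖
        ≤ (1 + ‖x‖) ^ p * (n.factorial * Real.exp (f x) * ((C + 1) * (1 + ‖x‖) ^ k) ^ n) := by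
          gcongr; linarith
      _ = n.factorial * (C + 1) ^ n * ((1 + ‖x‖) ^ (k * n + p) * Real.exp (-(‖x‖ ^ 2 / 4))) := by
          rw [show f x = -(‖x‖ ^ 2 / 4) by simp only [f]; ring, mul_pow, pow_add, pow_mul]
          ring
      _ ≤ _ := by
          exact mul_le_mul_of_nonneg_left (one_add_pow_mul_exp_le _ (norm_nonneg x)) (by positivity)
  · change Real.exp (f w) = _
    congr 1; simp only [f]; ring

/-! ### Twisted translations -/

/-- The symplectic form `½ Im ⟨w, z⟩` in the phase of the twisted translations. -/
noncomputable def phase {d : ℕ} (z w : Cn d) : ℝ := (inner ℂ w z).im / 2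

/-- The phase as a linear form in the second variable. -/
noncomputable def phaseCLM {d : ℕ} (z : Cn d) : Cn d →L[ℝ] ℝ :=
  LinearMap.toContinuousLinearMap
    { toFun := phase z
      map_add' := fun v w => by simp [phase, add_div]
      map_smul' := fun c v => by
        rw [phase, RCLike.real_smul_eq_coe_smul (K := ℂ) c v, inner_smul_left]
        simp [phase, mul_div_assoc] }

@[simp] lemma phaseCLM_apply {d : ℕ} (z w : Cn d) : phaseCLM z w = phase z w := rfl

lemma phase_swap {d : ℕ} (z w : Cn d) : phase z w = -phase w z := by
  rw [phase, phase, ← inner_conj_symm, Complex.conj_im]; ring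

lemma phase_self {d : ℕ} (z : Cn d) : phase z z = 0 := by
  linarith [phase_swap z z]

lemma continuous_phase {d : ℕ} : Continuous fun p : Cn d × Cn d => phase p.1 p.2 := by
  unfold phase; fun_prop

lemma phase_single_one {d : ℕ} (z : Cn d) (j : Fin d) :
    phase z (EuclideanSpace.single j (1 : ℂ)) = (z j).im / 2 := by
  simp [phase, EuclideanSpace.inner_single_left]

lemma phase_single_I {d : ℕ} (z : Cn d) (j : Fin d) :
    phase z (EuclideanSpace.single j Complex.I) = -(z j).re / 2 := by
  simp [phase, EuclideanSpace.inner_single_left]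

/-- The unimodular factor of the twisted translations. -/
noncomputable def phaseFactor {d : ℕ} (z w : Cn d) : ℂ := Complex.exp (Complex.I * phase z w)

lemma norm_phaseFactor {d : ℕ} (z w : Cn d) : ‖phaseFactor z w‖ = 1 := by
  rw [phaseFactor, mul_comm]; exact Complex.norm_exp_ofReal_mul_I _

lemma conj_phaseFactor {d : ℕ} (z w : Cn d) :
    starRingEnd ℂ (phaseFactor z w) = phaseFactor w z := by
  rw [phaseFactor, ← Complex.exp_conj, phaseFactor, phase_swap w z]; simp

lemma continuous_phaseFactor {d : ℕ} : Continuous fun p : Cn d × Cn d => phaseFactor p.1 p.2 := by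
  unfold phaseFactor
  exact Complex.continuous_exp.comp (continuous_const.mul
    (Complex.continuous_ofReal.comp continuous_phase))

lemma hasTemperateGrowth_exp_I :
    Function.HasTemperateGrowth (fun t : ℝ => Complex.exp (Complex.I * t)) := by
  have hcd : ContDiff ℝ ∞ (fun t : ℝ => Complex.exp (Complex.I * t)) :=
    (contDiff_const.mul Complex.ofRealCLM.contDiff).cexp
  have hd : ∀ n : ℕ, iteratedDeriv n (fun t : ℝ => Complex.exp (Complex.I * t)) =
      fun t : ℝ => Complex.I ^ n * Complex.exp (Complex.I * t) := by
    intro n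
    induction n with
    | zero => simp
    | succ n ih =>
      rw [iteratedDeriv_succ, ih]
      funext t
      have h1 : HasDerivAt (fun t : ℝ => Complex.I * (t : ℂ)) (Complex.I * 1) t :=
        (HasDerivAt.ofReal_comp (hasDerivAt_id t)).const_mul _
      rw [(h1.cexp.const_mul (Complex.I ^ n)).deriv]
      ring
  refine ⟨hcd, fun n => ⟨0, 1, fun t => ?_⟩⟩
  rw [norm_iteratedFDeriv_eq_norm_iteratedDeriv, hd, norm_mul, norm_pow, Complex.norm_I, mul_comm Complex.I,
    Complex.norm_exp_ofReal_mul_I]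
  simp

lemma hasTemperateGrowth_phaseFactor {d : ℕ} (z : Cn d) :
    Function.HasTemperateGrowth (phaseFactor z) :=
  hasTemperateGrowth_exp_I.comp (phaseCLM z).hasTemperateGrowth

lemma exists_twistedTranslation_eq {d : ℕ} (φ : 𝓢(Cn d, ℂ)) (z : Cn d) :
    ∃ ψ : 𝓢(Cn d, ℂ), ∀ w, ψ w = phaseFactor z w * φ (w - z) := by
  refine ⟨SchwartzMap.smulLeftCLM ℂ (phaseFactor z) (SchwartzMap.compSubConstCLM ℂ z φ), fun w => ?_⟩
  rw [SchwartzMap.smulLeftCLM_apply_apply (hasTemperateGrowth_phaseFactor z), smul_eq_mul]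
  simp

lemma hasLineDerivAt_twistedTranslation {d : ℕ} {f : Cn d → ℂ} (hf : Differentiable ℝ f)
    (z w v : Cn d) :
    lineDeriv ℝ (fun w => phaseFactor z w * f (w - z)) w v =
      phaseFactor z w * (lineDeriv ℝ f (w - z) v + Complex.I * phase z v * f (w - z)) := by
  have h1 : HasDerivAt (fun t : ℝ => phaseFactor z (w + t • v))
      (phaseFactor z w * (Complex.I * phase z v)) 0 := by
    have h2 : HasDerivAt (fun t : ℝ => Complex.I * ((phase z w + t * phase z v : ℝ) : ℂ))
        (Complex.I * ((1 * phase z v : ℝ) : ℂ)) 0 :=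
      (HasDerivAt.ofReal_comp (((hasDerivAt_id (0 : ℝ)).mul_const (phase z v)).const_add
        (phase z w))).const_mul _
    have h3 := h2.cexp
    simp only [zero_mul, add_zero, one_mul] at h3
    refine h3.congr_of_eventuallyEq (Filter.Eventually.of_forall fun t => ?_)
    simp only [phaseFactor, ← phaseCLM_apply, map_add, map_smul, smul_eq_mul]
  have h2 : HasDerivAt (fun t : ℝ => f (w - z + t • v)) (lineDeriv ℝ f (w - z) v) 0 :=
    (hf (w - z)).lineDifferentiableAt.hasLineDerivAt
  have h4 := h1.mul h2
  have h5 : HasLineDerivAt ℝ (fun w => phaseFactor z w * f (w - z))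
      (phaseFactor z w * (lineDeriv ℝ f (w - z) v + Complex.I * phase z v * f (w - z))) w v := by
    refine (h4.congr_deriv ?_).congr_of_eventuallyEq (Filter.Eventually.of_forall fun t => ?_)
    · simp; ring
    · simp only [Pi.mul_apply]
      rw [add_sub_right_comm]
  exact h5.lineDeriv

/-- Differentiating the phase adds (i/2) Im z_j, which turns the potential -(i/2) Im w_j into -(i/2)
Im (w - z)_j. -/
lemma opX_twistedTranslation {d : ℕ} (j : Fin d) {f : Cn d → ℂ} (hf : Differentiable ℝ f)
    (z : Cn d) :
    opX j (fun w => phaseFactor z w * f (w - z)) = fun w => phaseFactor z w * opX j f (w - z) := by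
  funext w
  rw [opX, hasLineDerivAt_twistedTranslation hf, phase_single_one, opX]
  simp
  ring

lemma opY_twistedTranslation {d : ℕ} (j : Fin d) {f : Cn d → ℂ} (hf : Differentiable ℝ f)
    (z : Cn d) :
    opY j (fun w => phaseFactor z w * f (w - z)) = fun w => phaseFactor z w * opY j f (w - z) := by
  funext w
  rw [opY, hasLineDerivAt_twistedTranslation hf, phase_single_I, opY]
  simp
  ring

/-- The twisted Laplacian commutes with the twisted translations. -/
lemma twistedLaplacian_twistedTranslation {d : ℕ} (φ : 𝓢(Cn d, ℂ)) (z w : Cn d) :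
    twistedLaplacian (fun w => phaseFactor z w * φ (w - z)) w =
      phaseFactor z w * twistedLaplacian φ (w - z) := by
  have hX : ∀ j, Differentiable ℝ (opX j φ) := fun j => by
    obtain ⟨ψ, hψ⟩ := exists_opX_eq j φ
    rw [← hψ]; exact ψ.differentiable
  have hY : ∀ j, Differentiable ℝ (opY j φ) := fun j => by
    obtain ⟨ψ, hψ⟩ := exists_opY_eq j φ
    rw [← hψ]; exact ψ.differentiable
  simp only [twistedLaplacian, opX_twistedTranslation _ φ.differentiable,
    opY_twistedTranslation _ φ.differentiable, opX_twistedTranslation _ (hX _),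
    opY_twistedTranslation _ (hY _)]
  rw [mul_neg, Finset.mul_sum]
  simp only [mul_add]

/-! ### Radial functions and Laguerre eigenfunctions -/

lemma hasDerivAt_radial {d : ℕ} {g : ℝ → ℂ} {g' : ℂ} (w v : Cn d)
    (hg : HasDerivAt g g' (‖w‖ ^ 2)) :
    HasDerivAt (fun t : ℝ => g (‖w + t • v‖ ^ 2)) ((2 * (inner ℂ w v).re : ℝ) * g') 0 := by
  have h1 : HasDerivAt (fun t : ℝ => ‖w + t • v‖ ^ 2) (2 * (inner ℂ w v).re) 0 := by
    have e : (fun t : ℝ => ‖w + t • v‖ ^ 2) =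
        fun t => ‖w‖ ^ 2 + t * (2 * (inner ℂ w v).re) + t ^ 2 * ‖v‖ ^ 2 := by
      funext t
      rw [norm_add_sq (𝕜 := ℂ), RCLike.real_smul_eq_coe_smul (K := ℂ), inner_smul_right, norm_smul,
        mul_pow]
      simp
      ring
    rw [e]
    have h2 := (((hasDerivAt_id (0 : ℝ)).mul_const (2 * (inner ℂ w v).re)).const_add
      (‖w‖ ^ 2)).add ((hasDerivAt_pow 2 (0 : ℝ)).mul_const (‖v‖ ^ 2))
    refine h2.congr_deriv ?_
    simp
  have h2 : HasDerivAt g g' (‖w + (0 : ℝ) • v‖ ^ 2) := by simpa using hg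
  refine (h2.scomp (0 : ℝ) h1).congr_deriv ?_
  simp

/-- The first-order mixed terms ∓2i Re(w_j) Im(w_j) g₁ of the two squares cancel, leaving an
ordinary differential operator in t = ‖w‖². -/
lemma twistedLaplacian_radial {d : ℕ} {g g₁ g₂ : ℝ → ℂ} (h1 : ∀ t, HasDerivAt g (g₁ t) t)
    (h2 : ∀ t, HasDerivAt g₁ (g₂ t) t) (w : Cn d) :
    twistedLaplacian (fun w => g (‖w‖ ^ 2)) w =
      -(4 * d * g₁ (‖w‖ ^ 2) + (‖w‖ ^ 2 : ℝ) * (4 * g₂ (‖w‖ ^ 2) - g (‖w‖ ^ 2) / 4)) := by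
  have ix : ∀ (w : Cn d) (j : Fin d), (inner ℂ w (EuclideanSpace.single j (1 : ℂ))).re = (w j).re := by
    intro w j; simp [EuclideanSpace.inner_single_right]
  have iy : ∀ (w : Cn d) (j : Fin d), (inner ℂ w (EuclideanSpace.single j Complex.I)).re = (w j).im := by
    intro w j; simp [EuclideanSpace.inner_single_right]
  have X1 : ∀ j, opX j (fun w : Cn d => g (‖w‖ ^ 2)) = fun w =>
      ((w j).re : ℂ) * (2 * g₁ (‖w‖ ^ 2)) - Complex.I / 2 * (w j).im * g (‖w‖ ^ 2) := by
    intro j; funext w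
    have h := hasDerivAt_radial w (EuclideanSpace.single j (1 : ℂ)) (h1 (‖w‖ ^ 2))
    rw [opX, HasLineDerivAt.lineDeriv (show HasLineDerivAt ℝ (fun w : Cn d => g (‖w‖ ^ 2)) _ w _ from h), ix]
    push_cast; ring
  have Y1 : ∀ j, opY j (fun w : Cn d => g (‖w‖ ^ 2)) = fun w =>
      ((w j).im : ℂ) * (2 * g₁ (‖w‖ ^ 2)) + Complex.I / 2 * (w j).re * g (‖w‖ ^ 2) := by
    intro j; funext w
    have h := hasDerivAt_radial w (EuclideanSpace.single j Complex.I) (h1 (‖w‖ ^ 2))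
    rw [opY, HasLineDerivAt.lineDeriv (show HasLineDerivAt ℝ (fun w : Cn d => g (‖w‖ ^ 2)) _ w _ from h), iy]
    push_cast; ring
  have X2 : ∀ j, opX j (opX j (fun w : Cn d => g (‖w‖ ^ 2))) w = 2 * g₁ (‖w‖ ^ 2)
      + 4 * (w j).re ^ 2 * g₂ (‖w‖ ^ 2) - 2 * Complex.I * (w j).re * (w j).im * g₁ (‖w‖ ^ 2)
      - (w j).im ^ 2 / 4 * g (‖w‖ ^ 2) := by
    intro j
    have ha := hasDerivAt_radial w (EuclideanSpace.single j (1 : ℂ)) (h1 (‖w‖ ^ 2))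
    have hb := hasDerivAt_radial w (EuclideanSpace.single j (1 : ℂ)) (h2 (‖w‖ ^ 2))
    have hc : HasDerivAt (fun t : ℝ =>
        ((((w + t • EuclideanSpace.single j (1 : ℂ)) : Cn d) j).re : ℂ)) ((1 : ℝ) : ℂ) 0 := by
      refine HasDerivAt.ofReal_comp (f := fun t : ℝ => (((w + t • EuclideanSpace.single j (1 : ℂ)) : Cn d) j).re) ?_
      simpa using (hasDerivAt_id (0 : ℝ)).const_add ((w j).re)
    have hd : HasDerivAt (fun t : ℝ => Complex.I / 2 *
        ((((w + t • EuclideanSpace.single j (1 : ℂ)) : Cn d) j).im : ℂ)) 0 0 := by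
      simpa using hasDerivAt_const (0 : ℝ) (Complex.I / 2 * ((w j).im : ℂ))
    have := (hc.mul (hb.const_mul 2)).sub (hd.mul ha)
    rw [opX, X1, HasLineDerivAt.lineDeriv (show HasLineDerivAt ℝ (fun w : Cn d =>
      ((w j).re : ℂ) * (2 * g₁ (‖w‖ ^ 2)) - Complex.I / 2 * (w j).im * g (‖w‖ ^ 2)) _ w _ from this), ix]
    simp
    ring_nf
    rw [Complex.I_sq]
    ring
  have Y2 : ∀ j, opY j (opY j (fun w : Cn d => g (‖w‖ ^ 2))) w = 2 * g₁ (‖w‖ ^ 2)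
      + 4 * (w j).im ^ 2 * g₂ (‖w‖ ^ 2) + 2 * Complex.I * (w j).re * (w j).im * g₁ (‖w‖ ^ 2)
      - (w j).re ^ 2 / 4 * g (‖w‖ ^ 2) := by
    intro j
    have ha := hasDerivAt_radial w (EuclideanSpace.single j Complex.I) (h1 (‖w‖ ^ 2))
    have hb := hasDerivAt_radial w (EuclideanSpace.single j Complex.I) (h2 (‖w‖ ^ 2))
    have hc : HasDerivAt (fun t : ℝ =>
        ((((w + t • EuclideanSpace.single j Complex.I) : Cn d) j).im : ℂ)) ((1 : ℝ) : ℂ) 0 := by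
      refine HasDerivAt.ofReal_comp (f := fun t : ℝ => (((w + t • EuclideanSpace.single j Complex.I) : Cn d) j).im) ?_
      simpa using (hasDerivAt_id (0 : ℝ)).const_add ((w j).im)
    have hd : HasDerivAt (fun t : ℝ => Complex.I / 2 *
        ((((w + t • EuclideanSpace.single j Complex.I) : Cn d) j).re : ℂ)) 0 0 := by
      simpa using hasDerivAt_const (0 : ℝ) (Complex.I / 2 * ((w j).re : ℂ))
    have := (hc.mul (hb.const_mul 2)).add (hd.mul ha)
    rw [opY, Y1, HasLineDerivAt.lineDeriv (show HasLineDerivAt ℝ (fun w : Cn d =>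
      ((w j).im : ℂ) * (2 * g₁ (‖w‖ ^ 2)) + Complex.I / 2 * (w j).re * g (‖w‖ ^ 2)) _ w _ from this), iy]
    simp
    ring_nf
    rw [Complex.I_sq]
    ring
  have hn : ((‖w‖ ^ 2 : ℝ) : ℂ) = ∑ j, (((w j).re : ℂ) ^ 2 + ((w j).im : ℂ) ^ 2) := by
    rw [EuclideanSpace.norm_sq_eq]
    push_cast
    refine Finset.sum_congr rfl fun j _ => ?_
    rw [← Complex.ofReal_pow, Complex.sq_norm, Complex.normSq_apply]; push_cast; ring
  rw [twistedLaplacian, hn, Finset.sum_mul]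
  simp only [X2, Y2]
  congr 1
  rw [show 4 * (d : ℂ) * g₁ (‖w‖ ^ 2) = ∑ _j : Fin d, 4 * g₁ (‖w‖ ^ 2) by simp; ring,
    ← Finset.sum_add_distrib]
  refine Finset.sum_congr rfl fun j _ => ?_
  ring

/-- The Laguerre function `L_k^{(α)}(|u|² / 2) e^{-|u|² / 4}`. -/
noncomputable def laguerreFun {d : ℕ} (α k : ℕ) (u : Cn d) : ℝ :=
  laguerre α k (‖u‖ ^ 2 / 2) * Real.exp (-(‖u‖ ^ 2 / 4))

lemma exists_laguerreFun_eq (d α k : ℕ) :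
    ∃ ψ : 𝓢(Cn d, ℂ), ∀ w, ψ w = (laguerreFun α k w : ℂ) := by
  obtain ⟨G, hG⟩ := exists_schwartz_gaussian d
  have hsq : Function.HasTemperateGrowth (fun w : Cn d => ‖w‖ ^ 2) :=
    Function.hasTemperateGrowth_norm_sq (Cn d)
  have hL : Function.HasTemperateGrowth (fun w : Cn d => laguerre α k (‖w‖ ^ 2 / 2)) := by
    have : (fun w : Cn d => laguerre α k (‖w‖ ^ 2 / 2)) = fun w => ∑ i ∈ Finset.range (k + 1),
        (-1) ^ i * ((k + α).choose (α + i) : ℝ) / (i.factorial : ℝ) * (‖w‖ ^ 2 * (1 / 2)) ^ i := by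
      funext w; simp only [laguerre]; congr! 3; ring
    rw [this]
    exact Function.HasTemperateGrowth.sum fun i _ => (Function.HasTemperateGrowth.const _).mul
      ((hsq.mul (Function.HasTemperateGrowth.const _)).pow i)
  refine ⟨SchwartzMap.postcompCLM Complex.ofRealCLM (SchwartzMap.smulLeftCLM ℝ
    (fun w : Cn d => laguerre α k (‖w‖ ^ 2 / 2)) G), fun w => ?_⟩
  rw [SchwartzMap.postcompCLM_apply, SchwartzMap.smulLeftCLM_apply_apply hL, hG]
  simp [laguerreFun]

/-- For L(t/2) e^{-t/4} the radial equation is Laguerre's equation at t/2. -/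
lemma twistedLaplacian_laguerreFun (α k : ℕ) (w : Cn (α + 1)) :
    twistedLaplacian (fun w : Cn (α + 1) => (laguerreFun α k w : ℂ)) w =
      ((α : ℂ) + 1 + 2 * k) * laguerreFun α k w := by
  obtain ⟨p₁, p₂, h1, h2, h3⟩ := laguerre_ode α k
  let g : ℝ → ℝ := fun t => laguerre α k (t / 2) * Real.exp (-(t / 4))
  let g₁ : ℝ → ℝ := fun t => (p₁ (t / 2) / 2 - laguerre α k (t / 2) / 4) * Real.exp (-(t / 4))
  let g₂ : ℝ → ℝ := fun t =>
    (p₂ (t / 2) / 4 - p₁ (t / 2) / 4 + laguerre α k (t / 2) / 16) * Real.exp (-(t / 4))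
  have he : ∀ t : ℝ, HasDerivAt (fun t : ℝ => Real.exp (-(t / 4))) (-(1 / 4) * Real.exp (-(t / 4))) t := by
    intro t
    have := (((hasDerivAt_id t).div_const 4).neg).exp
    simpa [mul_comm] using this
  have hc : ∀ {f f' : ℝ → ℝ}, (∀ x, HasDerivAt f (f' x) x) → ∀ t : ℝ,
      HasDerivAt (fun t => f (t / 2)) (f' (t / 2) / 2) t := by
    intro f f' hf t
    refine ((hf (t / 2)).comp t ((hasDerivAt_id t).div_const 2)).congr_deriv ?_
    simp [div_eq_mul_inv]
  have d1 : ∀ t, HasDerivAt g (g₁ t) t := fun t =>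
    ((hc h1 t).mul (he t)).congr_deriv (by simp only [g₁]; ring)
  have d2 : ∀ t, HasDerivAt g₁ (g₂ t) t := fun t =>
    ((((hc h2 t).div_const 2).sub ((hc h1 t).div_const 4)).mul (he t)).congr_deriv
      (by simp only [g₂, Pi.sub_apply]; ring)
  have hmain := twistedLaplacian_radial (d := α + 1) (g := fun t => (g t : ℂ))
    (g₁ := fun t => (g₁ t : ℂ)) (g₂ := fun t => (g₂ t : ℂ))
    (fun t => (d1 t).ofReal_comp) (fun t => (d2 t).ofReal_comp) w
  refine hmain.trans ?_
  have e := h3 (‖w‖ ^ 2 / 2)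
  have : -(4 * (α + 1) * g₁ (‖w‖ ^ 2) + ‖w‖ ^ 2 * (4 * g₂ (‖w‖ ^ 2) - g (‖w‖ ^ 2) / 4)) =
      ((α : ℝ) + 1 + 2 * k) * laguerreFun α k w := by
    simp only [g, g₁, g₂, laguerreFun]
    linear_combination (-2 * Real.exp (-(‖w‖ ^ 2 / 4))) * e
  exact_mod_cast congrArg (fun x : ℝ => (x : ℂ)) this

/-! ### Symmetry and membership in the eigenspaces -/

lemma integrable_schwartz_mul {d : ℕ} (f g : 𝓢(Cn d, ℂ)) : Integrable (fun z => f z * g z) :=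
  (f.memLp 2 (volume : Measure (Cn d))).integrable_mul (g.memLp 2 (volume : Measure (Cn d)))

lemma exists_conj_schwartz {d : ℕ} (φ : 𝓢(Cn d, ℂ)) : ∃ ψ : 𝓢(Cn d, ℂ),
    (∀ z, ψ z = starRingEnd ℂ (φ z)) ∧
    ∀ v z, (∂_{v} ψ) z = starRingEnd ℂ (lineDeriv ℝ φ z v) := by
  refine ⟨SchwartzMap.postcompCLM (Complex.conjCLE : ℂ →L[ℝ] ℂ) φ, fun z => rfl, fun v z => ?_⟩
  rw [SchwartzMap.lineDerivOp_apply]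
  have h : HasDerivAt (fun t : ℝ => φ (z + t • v)) (lineDeriv ℝ φ z v) 0 :=
    (φ.differentiable z).lineDifferentiableAt.hasLineDerivAt
  have h2 := (Complex.conjCLE : ℂ →L[ℝ] ℂ).hasFDerivAt.comp_hasDerivAt (0 : ℝ) h
  exact HasLineDerivAt.lineDeriv h2

/-- Integration by parts makes the derivative skew, and multiplication by i m is skew because m is
real. -/
lemma integral_mul_conj_op_eq_neg {d : ℕ} (φ ψ φ' ψ' : 𝓢(Cn d, ℂ)) (v : Cn d) (m : Cn d → ℝ)
    (hφ : ∀ z, φ' z = lineDeriv ℝ φ z v + Complex.I * m z * φ z)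
    (hψ : ∀ z, ψ' z = lineDeriv ℝ ψ z v + Complex.I * m z * ψ z) :
    ∫ z, ψ z * starRingEnd ℂ (φ' z) = -∫ z, ψ' z * starRingEnd ℂ (φ z) := by
  obtain ⟨χ, hχ, hχd⟩ := exists_conj_schwartz φ
  obtain ⟨χ', hχ', -⟩ := exists_conj_schwartz φ'
  simp only [← hχ, ← hχ']
  rw [eq_neg_iff_add_eq_zero, ← integral_add (integrable_schwartz_mul _ _)
    (integrable_schwartz_mul _ _)]
  have h := SchwartzMap.integral_mul_lineDerivOp_right_eq_neg_left ψ χ v (μ := volume)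
  rw [eq_neg_iff_add_eq_zero, ← integral_add (integrable_schwartz_mul _ _)
    (integrable_schwartz_mul _ _)] at h
  rw [← h]
  refine integral_congr_ae (Filter.Eventually.of_forall fun z => ?_)
  simp only [hχ', hφ, hψ, hχd, hχ, SchwartzMap.lineDerivOp_apply, map_add, map_mul, Complex.conj_I,
    Complex.conj_ofReal]
  ring

lemma integral_mul_conj_opX {d : ℕ} (j : Fin d) (φ ψ φ' ψ' : 𝓢(Cn d, ℂ)) (hφ : ⇑φ' = opX j φ)
    (hψ : ⇑ψ' = opX j ψ) :
    ∫ z, ψ z * starRingEnd ℂ (φ' z) = -∫ z, ψ' z * starRingEnd ℂ (φ z) :=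
  integral_mul_conj_op_eq_neg φ ψ φ' ψ' (EuclideanSpace.single j 1) (fun z => -(z j).im / 2)
    (fun z => by rw [hφ, opX]; push_cast; ring) (fun z => by rw [hψ, opX]; push_cast; ring)

lemma integral_mul_conj_opY {d : ℕ} (j : Fin d) (φ ψ φ' ψ' : 𝓢(Cn d, ℂ)) (hφ : ⇑φ' = opY j φ)
    (hψ : ⇑ψ' = opY j ψ) :
    ∫ z, ψ z * starRingEnd ℂ (φ' z) = -∫ z, ψ' z * starRingEnd ℂ (φ z) :=
  integral_mul_conj_op_eq_neg φ ψ φ' ψ' (EuclideanSpace.single j Complex.I) (fun z => (z j).re / 2)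
    (fun z => by rw [hφ, opY]; push_cast; ring) (fun z => by rw [hψ, opY]; push_cast; ring)

/-- The twisted Laplacian is symmetric on Schwartz functions. -/
lemma integral_mul_conj_twistedLaplacian {d : ℕ} (φ ψ : 𝓢(Cn d, ℂ)) :
    ∫ z, ψ z * starRingEnd ℂ (twistedLaplacian φ z) =
      ∫ z, twistedLaplacian ψ z * starRingEnd ℂ (φ z) := by
  choose X hX using fun (χ : 𝓢(Cn d, ℂ)) (j : Fin d) => exists_opX_eq j χ
  choose Y hY using fun (χ : 𝓢(Cn d, ℂ)) (j : Fin d) => exists_opY_eq j χ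
  have hL : ∀ (χ : 𝓢(Cn d, ℂ)) z, twistedLaplacian χ z =
      -∑ j, (X (X χ j) j z + Y (Y χ j) j z) := by
    intro χ z
    simp only [twistedLaplacian, hX, hY]
  have hint : ∀ f g : 𝓢(Cn d, ℂ), Integrable (fun z => f z * starRingEnd ℂ (g z)) := by
    intro f g
    obtain ⟨χ, hχ, -⟩ := exists_conj_schwartz g
    simpa only [hχ] using integrable_schwartz_mul f χ
  simp only [hL, map_neg, map_sum, map_add, mul_neg, neg_mul, Finset.mul_sum, Finset.sum_mul,
    integral_neg, mul_add, add_mul]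
  have hint2 : ∀ f₁ g₁ f₂ g₂ : 𝓢(Cn d, ℂ), Integrable (fun z =>
      f₁ z * starRingEnd ℂ (g₁ z) + f₂ z * starRingEnd ℂ (g₂ z)) :=
    fun _ _ _ _ => (hint _ _).add (hint _ _)
  rw [integral_finsetSum _ fun j _ => hint2 _ _ _ _, integral_finsetSum _ fun j _ => hint2 _ _ _ _]
  congr 1
  refine Finset.sum_congr rfl fun j _ => ?_
  rw [integral_add (hint _ _) (hint _ _), integral_add (hint _ _) (hint _ _)]
  congr 1
  · rw [integral_mul_conj_opX j (X φ j) ψ _ _ (hX _ j) (hX _ j),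
      integral_mul_conj_opX j φ (X ψ j) _ _ (hX _ j) (hX _ j), neg_neg]
  · rw [integral_mul_conj_opY j (Y φ j) ψ _ _ (hY _ j) (hY _ j),
      integral_mul_conj_opY j φ (Y ψ j) _ _ (hY _ j) (hY _ j), neg_neg]

lemma toLp_mem_eigenspace {d : ℕ} {lam : ℝ} (ψ : 𝓢(Cn d, ℂ))
    (h : ∀ z, twistedLaplacian ψ z = lam * ψ z) :
    (ψ.memLp 2 (volume : Measure (Cn d))).toLp ∈ eigenspace d lam := by
  rw [mem_eigenspace_iff]
  intro φ
  have hae := (ψ.memLp 2 (volume : Measure (Cn d))).coeFn_toLp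
  have key : ∀ F : Cn d → ℂ, ∫ z, ((ψ.memLp 2 (volume : Measure (Cn d))).toLp : L2 d) z * F z =
      ∫ z, ψ z * F z := fun F => integral_congr_ae (by filter_upwards [hae] with z hz; rw [hz])
  rw [key, key, integral_mul_conj_twistedLaplacian, ← integral_const_mul]
  simp only [h, mul_assoc]

/-- The twisted translate to `z` of the Laguerre function: an eigenfunction of the twisted
Laplacian. -/
lemma exists_eigenfunction (α k : ℕ) (z : Cn (α + 1)) : ∃ ψ : 𝓢(Cn (α + 1), ℂ),
    (∀ w, ψ w = phaseFactor z w * laguerreFun α k (w - z)) ∧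
    ∀ w, twistedLaplacian ψ w = ((α + 1 + 2 * k : ℝ) : ℂ) * ψ w := by
  obtain ⟨φ, hφ⟩ := exists_laguerreFun_eq (α + 1) α k
  obtain ⟨ψ, hψ⟩ := exists_twistedTranslation_eq φ z
  refine ⟨ψ, fun w => by rw [hψ, hφ], fun w => ?_⟩
  rw [show (ψ : Cn (α + 1) → ℂ) = fun w => phaseFactor z w * φ (w - z) from funext hψ,
    twistedLaplacian_twistedTranslation,
    show (φ : Cn (α + 1) → ℂ) = fun w => (laguerreFun α k w : ℂ) from funext hφ,
    twistedLaplacian_laguerreFun]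
  push_cast
  ring

/-! ### The heat kernel as an approximate identity -/

lemma finrank_Cn (d : ℕ) : Module.finrank ℝ (Cn d) = 2 * d := by
  rw [← Module.finrank_mul_finrank ℝ ℂ (Cn d)]; simp

lemma integrable_norm_mul_norm {d : ℕ} {u v : Cn d → ℂ} (hu : MemLp u 2) (hv : MemLp v 2) :
    Integrable (fun z => ‖u z‖ * ‖v z‖) :=
  hu.norm.integrable_mul hv.norm

/-- An additive substitute for Cauchy–Schwarz: only bounds uniform under translation are needed. -/
lemma integral_norm_mul_norm_le {d : ℕ} {u v : Cn d → ℂ} (hu : MemLp u 2) (hv : MemLp v 2) :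
    ∫ z, ‖u z‖ * ‖v z‖ ≤ (∫ z, ‖u z‖ ^ 2) + ∫ z, ‖v z‖ ^ 2 := by
  have h1 : Integrable (fun z => ‖u z‖ ^ 2) := (memLp_two_iff_integrable_sq_norm hu.1).1 hu
  have h2 : Integrable (fun z => ‖v z‖ ^ 2) := (memLp_two_iff_integrable_sq_norm hv.1).1 hv
  rw [← integral_add h1 h2]
  refine integral_mono (integrable_norm_mul_norm hu hv) (h1.add h2) fun z => ?_
  simp only
  nlinarith [sq_nonneg (‖u z‖ - ‖v z‖), sq_nonneg (‖u z‖), sq_nonneg (‖v z‖)]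

/-- The kernel of `∑_k r ^ k 𝓟_{d + 2 k}` for `r = 1 - s ^ 2`. -/
noncomputable def heatKernel (d : ℕ) (s : ℝ) (z w : Cn d) : ℂ :=
  (((1 / (2 * Real.pi)) ^ d * (s⁻¹) ^ (2 * d) *
    Real.exp (-(‖w - z‖ ^ 2 * (2 - s ^ 2) / (4 * s ^ 2))) : ℝ) : ℂ) * phaseFactor w z

/-- The rescaled Gaussian factor of `heatKernel`. -/
noncomputable def heatGaussian (d : ℕ) (s : ℝ) (v : Cn d) : ℝ :=
  (1 / (2 * Real.pi)) ^ d * Real.exp (-((2 - s ^ 2) / 4) * ‖v‖ ^ 2)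

lemma heatGaussian_nonneg {d : ℕ} (s : ℝ) (v : Cn d) : 0 ≤ heatGaussian d s v := by
  unfold heatGaussian; positivity

lemma continuous_heatGaussian (d : ℕ) (s : ℝ) : Continuous (heatGaussian d s) := by
  unfold heatGaussian; fun_prop

lemma heatGaussian_le {d : ℕ} {s : ℝ} (hs : s ^ 2 ≤ 1) (v : Cn d) :
    heatGaussian d s v ≤ heatGaussian d 1 v := by
  unfold heatGaussian
  gcongr ?_ * Real.exp ?_
  nlinarith [sq_nonneg ‖v‖]

lemma integral_heatGaussian (d : ℕ) {s : ℝ} (hs : s ^ 2 < 2) :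
    ∫ v : Cn d, heatGaussian d s v = (2 / (2 - s ^ 2)) ^ d := by
  unfold heatGaussian
  rw [integral_const_mul, GaussianFourier.integral_rexp_neg_mul_sq_norm (by linarith), finrank_Cn]
  push_cast
  rw [mul_div_cancel_left₀ _ (two_ne_zero), Real.rpow_natCast, ← mul_pow]
  congr 1
  have : 2 - s ^ 2 ≠ 0 := by linarith
  field_simp
  norm_num

lemma integrable_heatGaussian (d : ℕ) {s : ℝ} (hs : s ^ 2 < 2) : Integrable (heatGaussian d s) := by
  by_contra h
  have h1 := integral_heatGaussian d hs
  rw [integral_undef h] at h1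
  have : 0 < (2 / (2 - s ^ 2)) ^ d := pow_pos (div_pos two_pos (by linarith)) d
  linarith

/-- Substituting w = z + s v, the Jacobian s^{2d} cancels the singular prefactor, and the Gaussian
becomes regular at s = 0. -/
lemma integral_heatKernel_mul {d : ℕ} {s : ℝ} (hs : 0 < s) (z : Cn d) (f : Cn d → ℂ) :
    ∫ w, heatKernel d s z w * f w = ∫ v : Cn d, (heatGaussian d s v : ℂ) *
      (phaseFactor (z + s • v) z * f (z + s • v)) := by
  have h1 := Measure.integral_comp_smul (volume : Measure (Cn d))
    (fun w => heatKernel d s z (z + w) * f (z + w)) s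
  rw [integral_add_left_eq_self (fun w => heatKernel d s z w * f w) z, finrank_Cn] at h1
  have hpos : 0 < s ^ (2 * d) := by positivity
  rw [abs_of_pos (by positivity)] at h1
  have h2 : ∫ w, heatKernel d s z w * f w = (s ^ (2 * d)) •
      ∫ v : Cn d, heatKernel d s z (z + s • v) * f (z + s • v) := by
    rw [h1, smul_smul, mul_inv_cancel₀ hpos.ne', one_smul]
  rw [h2, ← integral_smul]
  refine integral_congr_ae (Filter.Eventually.of_forall fun v => ?_)
  simp only [heatKernel, heatGaussian]
  rw [add_sub_cancel_left, norm_smul, Real.norm_of_nonneg hs.le, Complex.real_smul, mul_pow,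
    inv_pow, show s ^ 2 * ‖v‖ ^ 2 * (2 - s ^ 2) / (4 * s ^ 2) = (2 - s ^ 2) / 4 * ‖v‖ ^ 2 by
      field_simp, neg_mul]
  have hc : (s : ℂ) ≠ 0 := by exact_mod_cast hs.ne'
  push_cast
  field_simp

lemma memLp_shift {d : ℕ} {f : Cn d → ℂ} (hf : MemLp f 2) (a : Cn d) :
    MemLp (fun z => f (z + a)) 2 :=
  hf.comp_measurePreserving (measurePreserving_add_right volume a)

/-- Against a test function, the heat kernel can be integrated first over the rescaled variable. -/
lemma integral_mul_integral_heatKernel {d : ℕ} {s : ℝ} (hs : 0 < s) (hs1 : s ≤ 1) {f : Cn d → ℂ}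
    (hfm : StronglyMeasurable f) (hf : MemLp f 2) {g : Cn d → ℂ} (hg : Continuous g)
    (hgc : HasCompactSupport g) :
    ∫ z, g z * ∫ w, heatKernel d s z w * f w = ∫ v : Cn d, (heatGaussian d s v : ℂ) *
      ∫ z, g (z - s • v) * (phaseFactor z (z - s • v) * f z) := by
  have hs2 : s ^ 2 ≤ 1 := by nlinarith
  have hgL : MemLp g 2 (volume : Measure (Cn d)) := hg.memLp_of_hasCompactSupport hgc
  simp_rw [integral_heatKernel_mul hs, ← integral_const_mul]
  set h : Cn d → Cn d → ℂ := fun z v =>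
    g z * ((heatGaussian d s v : ℂ) * (phaseFactor (z + s • v) z * f (z + s • v))) with hh
  have hm : StronglyMeasurable (Function.uncurry h) := by
    have c1 : Continuous fun p : Cn d × Cn d => p.1 + s • p.2 := by fun_prop
    have m1 : StronglyMeasurable fun p : Cn d × Cn d => f (p.1 + s • p.2) :=
      hfm.comp_measurable c1.measurable
    have m2 : StronglyMeasurable fun p : Cn d × Cn d => phaseFactor (p.1 + s • p.2) p.1 :=
      (continuous_phaseFactor.comp (c1.prodMk continuous_fst)).stronglyMeasurable
    have m3 : StronglyMeasurable fun p : Cn d × Cn d => (heatGaussian d s p.2 : ℂ) :=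
      (Complex.continuous_ofReal.comp
        ((continuous_heatGaussian d s).comp continuous_snd)).stronglyMeasurable
    exact (hg.comp continuous_fst).stronglyMeasurable.mul (m3.mul (m2.mul m1))
  have hnorm : ∀ z v, ‖h z v‖ = heatGaussian d s v * (‖g z‖ * ‖f (z + s • v)‖) := by
    intro z v
    rw [hh]
    simp only [norm_mul, norm_phaseFactor, Complex.norm_real, one_mul,
      Real.norm_of_nonneg (heatGaussian_nonneg s v)]
    ring
  have hint : Integrable (Function.uncurry h) (volume.prod volume) := by
    rw [integrable_prod_iff' hm.aestronglyMeasurable]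
    constructor
    · refine Filter.Eventually.of_forall fun v => ?_
      have hmv : AEStronglyMeasurable (fun z => Function.uncurry h (z, v)) volume :=
        (hm.comp_measurable (measurable_id.prodMk measurable_const)).aestronglyMeasurable
      refine ((integrable_norm_mul_norm hgL (memLp_shift hf (s • v))).const_mul
        (heatGaussian d s v)).mono' hmv (Filter.Eventually.of_forall fun z => ?_)
      exact (hnorm z v).le
    · have hmI : StronglyMeasurable fun v => ∫ z, ‖Function.uncurry h (z, v)‖ := by
        have : StronglyMeasurable (Function.uncurry fun z v => ‖h z v‖) := hm.norm
        exact this.integral_prod_left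
      refine ((integrable_heatGaussian d (s := s) (by linarith)).mul_const
        ((∫ z, ‖g z‖ ^ 2) + ∫ z, ‖f z‖ ^ 2)).mono' hmI.aestronglyMeasurable
        (Filter.Eventually.of_forall fun v => ?_)
      rw [Real.norm_of_nonneg (by positivity)]
      simp only [Function.uncurry_apply_pair, hnorm]
      rw [integral_const_mul]
      refine mul_le_mul_of_nonneg_left ?_ (heatGaussian_nonneg s v)
      refine (integral_norm_mul_norm_le hgL (memLp_shift hf (s • v))).trans (le_of_eq ?_)
      rw [integral_add_right_eq_self (fun z => ‖f z‖ ^ 2)]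
  rw [integral_integral_swap hint]
  refine integral_congr_ae (Filter.Eventually.of_forall fun v => ?_)
  simp only [hh]
  -- The shift is moved from f, which is only in L², to the continuous g, so that pointwise limits
  -- as s → 0 are available.
  rw [← integral_sub_right_eq_self _ (s • v)]
  refine integral_congr_ae (Filter.Eventually.of_forall fun z => ?_)
  simp only [sub_add_cancel]
  ring

/-- Dominated convergence: for 0 < s ≤ 1 the shifted g lives in one fixed ball, where f is
integrable, and the phase tends to 1. -/
lemma tendsto_integral_shift_mul {d : ℕ} {f : Cn d → ℂ} (hfm : StronglyMeasurable f)
    (hf : MemLp f 2) {g : Cn d → ℂ} (hg : Continuous g) (hgc : HasCompactSupport g) (v : Cn d) :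
    Filter.Tendsto (fun s : ℝ => ∫ z, g (z - s • v) * (phaseFactor z (z - s • v) * f z))
      (nhdsWithin 0 (Set.Ioc 0 1)) (nhds (∫ z, g z * f z)) := by
  obtain ⟨B, hB⟩ := hg.bounded_above_of_compact_support hgc
  have hB0 : 0 ≤ B := (norm_nonneg _).trans (hB 0)
  obtain ⟨ρ, hρ⟩ := hgc.isCompact.isBounded.subset_closedBall (0 : Cn d)
  let S : Set (Cn d) := Metric.closedBall 0 (ρ + ‖v‖)
  refine tendsto_integral_filter_of_dominated_convergence
    (S.indicator fun z => B * ‖f z‖) ?_ ?_ ?_ ?_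
  · refine Filter.Eventually.of_forall fun s => ?_
    have c1 : Continuous fun z : Cn d => z - s • v := by fun_prop
    exact ((hg.comp c1).stronglyMeasurable.mul ((continuous_phaseFactor.comp
      (continuous_id.prodMk c1)).stronglyMeasurable.mul hfm)).aestronglyMeasurable
  · filter_upwards [self_mem_nhdsWithin] with s hs
    refine Filter.Eventually.of_forall fun z => ?_
    rw [norm_mul, norm_mul, norm_phaseFactor, one_mul]
    by_cases hz : z ∈ S
    · rw [Set.indicator_of_mem hz]
      exact mul_le_mul_of_nonneg_right (hB _) (norm_nonneg _)
    · have h0 : g (z - s • v) = 0 := image_eq_zero_of_notMem_tsupport fun h => by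
        apply hz
        have h1 := hρ h
        rw [mem_closedBall_zero_iff] at h1 ⊢
        calc ‖z‖ = ‖(z - s • v) + s • v‖ := by rw [sub_add_cancel]
          _ ≤ ‖z - s • v‖ + ‖s • v‖ := norm_add_le _ _
          _ ≤ ρ + ‖v‖ := by
            refine add_le_add h1 ?_
            rw [norm_smul, Real.norm_of_nonneg hs.1.le]
            exact mul_le_of_le_one_left (norm_nonneg _) hs.2
      rw [Set.indicator_of_notMem hz, h0, norm_zero, zero_mul]
  · rw [integrable_indicator_iff Metric.isClosed_closedBall.measurableSet]
    exact ((hf.locallyIntegrable one_le_two).integrableOn_isCompact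
      (isCompact_closedBall _ _)).norm.const_mul B
  · refine Filter.Eventually.of_forall fun z => ?_
    have hc : Continuous fun s : ℝ => g (z - s • v) * (phaseFactor z (z - s • v) * f z) := by
      have c1 : Continuous fun s : ℝ => z - s • v := by fun_prop
      exact (hg.comp c1).mul ((continuous_phaseFactor.comp
        (continuous_const.prodMk c1)).mul continuous_const)
    have := (hc.tendsto 0).mono_left (nhdsWithin_le_nhds (s := Set.Ioc (0 : ℝ) 1))
    simpa [phaseFactor, phase_self] using this

/-- The heat kernel is an approximate identity. -/
lemma tendsto_integral_mul_heatKernel {d : ℕ} {f : Cn d → ℂ} (hfm : StronglyMeasurable f)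
    (hf : MemLp f 2) {g : Cn d → ℂ} (hg : Continuous g) (hgc : HasCompactSupport g) :
    Filter.Tendsto (fun s : ℝ => ∫ z, g z * ∫ w, heatKernel d s z w * f w)
      (nhdsWithin 0 (Set.Ioc 0 1)) (nhds (∫ z, g z * f z)) := by
  have hgL : MemLp g 2 (volume : Measure (Cn d)) := hg.memLp_of_hasCompactSupport hgc
  have hlim : ∫ v : Cn d, (heatGaussian d 0 v : ℂ) * ∫ z, g z * f z = ∫ z, g z * f z := by
    rw [integral_mul_const, integral_complex_ofReal, integral_heatGaussian d (by norm_num)]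
    simp
  rw [← hlim]
  have heq : (fun s : ℝ => ∫ z, g z * ∫ w, heatKernel d s z w * f w)
      =ᶠ[nhdsWithin 0 (Set.Ioc 0 1)] fun s => ∫ v : Cn d, (heatGaussian d s v : ℂ) *
      ∫ z, g (z - s • v) * (phaseFactor z (z - s • v) * f z) := by
    filter_upwards [self_mem_nhdsWithin] with s hs
    exact integral_mul_integral_heatKernel hs.1 hs.2 hfm hf hg hgc
  refine Filter.Tendsto.congr' heq.symm ?_
  refine tendsto_integral_filter_of_dominated_convergence
    (fun v => heatGaussian d 1 v * ((∫ z, ‖g z‖ ^ 2) + ∫ z, ‖f z‖ ^ 2)) ?_ ?_ ?_ ?_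
  · refine Filter.Eventually.of_forall fun s => ?_
    have c1 : Continuous fun p : Cn d × Cn d => p.1 - s • p.2 := by fun_prop
    have hm : StronglyMeasurable (Function.uncurry fun z v : Cn d =>
        g (z - s • v) * (phaseFactor z (z - s • v) * f z)) :=
      (hg.comp c1).stronglyMeasurable.mul ((continuous_phaseFactor.comp
        (continuous_fst.prodMk c1)).stronglyMeasurable.mul (hfm.comp_measurable measurable_fst))
    exact ((Complex.continuous_ofReal.comp (continuous_heatGaussian d s)).stronglyMeasurable.mul
      hm.integral_prod_left).aestronglyMeasurable
  · filter_upwards [self_mem_nhdsWithin] with s hs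
    refine Filter.Eventually.of_forall fun v => ?_
    rw [norm_mul, Complex.norm_real, Real.norm_of_nonneg (heatGaussian_nonneg s v)]
    refine mul_le_mul (heatGaussian_le (by nlinarith [hs.1, hs.2]) v) ?_ (norm_nonneg _)
      (heatGaussian_nonneg 1 v)
    refine (norm_integral_le_integral_norm _).trans ?_
    simp only [norm_mul, norm_phaseFactor, one_mul]
    have hgs : MemLp (fun z => g (z - s • v)) 2 :=
      hgL.comp_measurePreserving (measurePreserving_sub_right volume (s • v))
    refine (integral_norm_mul_norm_le hgs hf).trans (le_of_eq ?_)
    rw [integral_sub_right_eq_self (fun z => ‖g z‖ ^ 2)]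
  · exact (integrable_heatGaussian d (by norm_num)).mul_const _
  · refine Filter.Eventually.of_forall fun v => ?_
    refine Filter.Tendsto.mul ?_ (tendsto_integral_shift_mul hfm hf hg hgc v)
    have hc : Continuous fun s : ℝ => (heatGaussian d s v : ℂ) := by
      unfold heatGaussian; fun_prop
    exact (hc.tendsto 0).mono_left nhdsWithin_le_nhds

/-- Tested against smooth compactly supported g, the left side tends to ∫ g f and the right to ∫ g
c, because (1 - s²)^k → 1. -/
lemma ae_eq_of_integral_heatKernel_mul {d : ℕ} {f c : Cn d → ℂ} (hfm : StronglyMeasurable f)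
    (hf : MemLp f 2) (hc : LocallyIntegrable c) (k : ℕ)
    (h : ∀ s : ℝ, 0 < s → s < 1 → ∀ z, ∫ w, heatKernel d s z w * f w = ((1 - s ^ 2) ^ k : ℝ) * c z) :
    f =ᵐ[volume] c := by
  refine ae_eq_of_integral_contDiff_smul_eq (hf.locallyIntegrable one_le_two) hc
    fun g hg hgc => ?_
  let G : Cn d → ℂ := fun z => (g z : ℂ)
  have hG : Continuous G := Complex.continuous_ofReal.comp hg.continuous
  have hGc : HasCompactSupport G := hgc.comp_left (g := fun x : ℝ => (x : ℂ)) rfl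
  have h1 := tendsto_integral_mul_heatKernel hfm hf hG hGc
  have h2 : Filter.Tendsto (fun s : ℝ => ∫ z, G z * ∫ w, heatKernel d s z w * f w)
      (nhdsWithin 0 (Set.Ioc 0 1)) (nhds (∫ z, G z * c z)) := by
    have hcont : Continuous fun s : ℝ => (((1 - s ^ 2) ^ k : ℝ) : ℂ) * ∫ z, G z * c z := by
      fun_prop
    have h3 := (hcont.tendsto 0).mono_left (nhdsWithin_le_nhds (s := Set.Ioc (0 : ℝ) 1))
    simp only [ne_eq, OfNat.ofNat_ne_zero, not_false_eq_true, zero_pow, sub_zero, one_pow,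
      Complex.ofReal_one, one_mul] at h3
    refine h3.congr' ?_
    have hlt : ∀ᶠ s : ℝ in nhdsWithin 0 (Set.Ioc 0 1), s < 1 :=
      nhdsWithin_le_nhds (Iio_mem_nhds one_pos)
    filter_upwards [self_mem_nhdsWithin, hlt] with s hs hs1
    rw [← integral_const_mul]
    refine integral_congr_ae (Filter.Eventually.of_forall fun z => ?_)
    simp only [h s hs.1 hs1]
    ring
  have hne : (nhdsWithin (0 : ℝ) (Set.Ioc 0 1)).NeBot := by
    rw [nhdsWithin_Ioc_eq_nhdsGT one_pos]; infer_instance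
  simpa only [Complex.real_smul] using tendsto_nhds_unique h1 h2

/-! ### Kernels of the spectral projections -/

/-- The integral kernel of the spectral projection for the eigenvalue `α + 1 + 2 k`. -/
noncomputable def projKernel (α k : ℕ) (z w : Cn (α + 1)) : ℂ :=
  (((1 / (2 * Real.pi)) ^ (α + 1) * laguerreFun α k (w - z) : ℝ) : ℂ) * phaseFactor w z

lemma continuous_laguerreFun {d : ℕ} (α k : ℕ) : Continuous (laguerreFun (d := d) α k) := by
  unfold laguerreFun
  exact ((differentiable_laguerre α k).continuous.comp (by fun_prop)).mul (by fun_prop)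

lemma continuous_phaseFactor_swap {d : ℕ} :
    Continuous fun p : Cn d × Cn d => phaseFactor p.2 p.1 := by
  have h := continuous_phaseFactor.comp
    (continuous_snd.prodMk (continuous_fst (X := Cn d) (Y := Cn d)))
  exact h

lemma continuous_laguerreFun_sub {d : ℕ} (α k : ℕ) :
    Continuous fun p : Cn d × Cn d => laguerreFun α k (p.2 - p.1) :=
  (continuous_laguerreFun α k).comp (continuous_snd.sub continuous_fst)

lemma continuous_projKernel (α k : ℕ) : Continuous (Function.uncurry (projKernel α k)) := by
  have h4 := Complex.continuous_ofReal.comp ((continuous_const (y :=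
    (1 / (2 * Real.pi)) ^ (α + 1))).mul (continuous_laguerreFun_sub (d := α + 1) α k))
  exact h4.mul continuous_phaseFactor_swap

lemma norm_projKernel (α k : ℕ) (z w : Cn (α + 1)) :
    ‖projKernel α k z w‖ = (1 / (2 * Real.pi)) ^ (α + 1) * |laguerreFun α k (w - z)| := by
  rw [projKernel, norm_mul, norm_phaseFactor, mul_one, Complex.norm_real, norm_mul,
    Real.norm_of_nonneg (by positivity), Real.norm_eq_abs]

lemma exists_projKernel_eq (α k : ℕ) (z : Cn (α + 1)) : ∃ ψ : 𝓢(Cn (α + 1), ℂ),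
    (∀ w, projKernel α k z w = starRingEnd ℂ (ψ w)) ∧
    ∀ w, twistedLaplacian ψ w = ((α + 1 + 2 * k : ℝ) : ℂ) * ψ w := by
  obtain ⟨ψ, h1, h2⟩ := exists_eigenfunction α k z
  let b : ℂ := (((1 / (2 * Real.pi)) ^ (α + 1) : ℝ) : ℂ)
  obtain ⟨X, hX⟩ : ∃ ψ' : 𝓢(Cn (α + 1), ℂ), ψ' = b • ψ := ⟨_, rfl⟩
  have hXc : ∀ w, X w = b * ψ w := fun w => by rw [hX]; rfl
  refine ⟨X, fun w => ?_, fun w => ?_⟩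
  · rw [hXc, h1, map_mul, map_mul, conj_phaseFactor, Complex.conj_ofReal, Complex.conj_ofReal,
      projKernel]
    push_cast
    ring
  · have hop : ∀ f : Cn (α + 1) → ℂ, ∀ j, opX j (fun w => b * f w) = fun w => b * opX j f w := by
      intro f j; funext w
      have : lineDeriv ℝ (fun w => b * f w) w (EuclideanSpace.single j 1) =
          b * lineDeriv ℝ f w (EuclideanSpace.single j 1) := by
        simp only [lineDeriv]; exact deriv_const_mul_field b
      rw [opX, opX, this]; ring
    have hop2 : ∀ f : Cn (α + 1) → ℂ, ∀ j, opY j (fun w => b * f w) = fun w => b * opY j f w := by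
      intro f j; funext w
      have : lineDeriv ℝ (fun w => b * f w) w (EuclideanSpace.single j Complex.I) =
          b * lineDeriv ℝ f w (EuclideanSpace.single j Complex.I) := by
        simp only [lineDeriv]; exact deriv_const_mul_field b
      rw [opY, opY, this]; ring
    have h3 : twistedLaplacian X w = b * twistedLaplacian ψ w := by
      rw [show (X : Cn (α + 1) → ℂ) = fun w => b * ψ w from funext hXc]
      simp only [twistedLaplacian, hop, hop2]
      rw [mul_neg, Finset.mul_sum]
      simp only [mul_add]
    rw [h3, h2, hXc]; ring

lemma memLp_projKernel (α k : ℕ) (z : Cn (α + 1)) : MemLp (projKernel α k z) 2 := by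
  obtain ⟨ψ, h, -⟩ := exists_projKernel_eq α k z
  rw [show projKernel α k z = fun w => star (ψ w) from funext h]
  exact (ψ.memLp 2 (volume : Measure (Cn (α + 1)))).star

lemma integrable_projKernel_mul (α k : ℕ) (z : Cn (α + 1)) (f : L2 (α + 1)) :
    Integrable (fun w => projKernel α k z w * f w) :=
  (memLp_projKernel α k z).integrable_mul (Lp.memLp f)

/-- Orthogonality for distinct eigenvalues: the weak equation for f is tested on the Schwartz
eigenfunction conjugate to the kernel. -/
lemma integral_projKernel_mul_of_mem_eigenspace {α : ℕ} {lam : ℝ} {f : L2 (α + 1)}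
    (hf : f ∈ eigenspace (α + 1) lam) {k : ℕ} (hk : lam ≠ α + 1 + 2 * k) (z : Cn (α + 1)) :
    ∫ w, projKernel α k z w * f w = 0 := by
  obtain ⟨ψ, h1, h2⟩ := exists_projKernel_eq α k z
  have h := (mem_eigenspace_iff lam f).1 hf ψ
  simp only [h2, map_mul, Complex.conj_ofReal] at h
  have h3 : ∫ w, f w * (((α + 1 + 2 * k : ℝ) : ℂ) * starRingEnd ℂ (ψ w)) =
      ((α + 1 + 2 * k : ℝ) : ℂ) * ∫ w, f w * starRingEnd ℂ (ψ w) := by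
    rw [← integral_const_mul]; congr 1; funext w; ring
  rw [h3, ← sub_eq_zero, ← sub_mul, mul_eq_zero, ← Complex.ofReal_sub, Complex.ofReal_eq_zero,
    sub_eq_zero] at h
  simp only [h1, mul_comm _ (f _)]
  exact h.resolve_left hk.symm

lemma integral_projKernel_mul_of_mem_orthogonal {α k : ℕ} {f : L2 (α + 1)}
    (hf : f ∈ (eigenspace (α + 1) (α + 1 + 2 * k))ᗮ) (z : Cn (α + 1)) :
    ∫ w, projKernel α k z w * f w = 0 := by
  obtain ⟨ψ, h1, h2⟩ := exists_projKernel_eq α k z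
  have h := (Submodule.mem_orthogonal _ _).1 hf _ (toLp_mem_eigenspace ψ h2)
  rw [L2.inner_def] at h
  rw [← h]
  refine integral_congr_ae ?_
  filter_upwards [(ψ.memLp 2 (volume : Measure (Cn (α + 1)))).coeFn_toLp] with w hw
  rw [hw, h1]
  simp [mul_comm]

/-- Decay in u at a polynomial price in k, which the factor r^k of the Abel sum absorbs. -/
lemma abs_laguerreFun_mul_le {d : ℕ} (α k n : ℕ) (u : Cn d) :
    |laguerreFun α k u| * (1 + ‖u‖) ^ (2 * n) ≤ 2 * 32 ^ n * ((k : ℝ) + (α + n + 1)) ^ (α + n) := by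
  set x := ‖u‖ ^ 2 / 2 with hx
  have hx0 : 0 ≤ x := by positivity
  have h0 := pow_mul_abs_laguerre_le α k 0 hx0
  have hn := pow_mul_abs_laguerre_le α k n hx0
  set D := 4 ^ n * ((k : ℝ) + (α + n + 1)) ^ (α + n) with hD
  have hα : (0 : ℝ) ≤ α := Nat.cast_nonneg α
  have hn0 : (0 : ℝ) ≤ n := Nat.cast_nonneg n
  have hk0 : (0 : ℝ) ≤ k := Nat.cast_nonneg k
  have hD0 : ((k : ℝ) + α + 1) ^ α ≤ D := by
    have h4 : (1 : ℝ) ≤ 4 ^ n := one_le_pow₀ (by norm_num)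
    calc ((k : ℝ) + α + 1) ^ α ≤ ((k : ℝ) + (α + n + 1)) ^ α := by gcongr ?_ ^ _; linarith
      _ ≤ ((k : ℝ) + (α + n + 1)) ^ (α + n) := by gcongr <;> linarith
      _ ≤ D := le_mul_of_one_le_left (by positivity) h4
  have hE : Real.exp (x / 2) * Real.exp (-(‖u‖ ^ 2 / 4)) = 1 := by
    rw [← Real.exp_add, Real.exp_eq_one_iff, hx]; ring
  have hkey : (1 + x ^ n) * |laguerreFun α k u| ≤ 2 * D := by
    rw [laguerreFun, abs_mul, Real.abs_exp, ← hx]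
    simp only [pow_zero, one_mul, Nat.cast_zero, add_zero] at h0
    have hn' : x ^ n * |laguerre α k x| ≤ D * Real.exp (x / 2) := by
      rw [hD]; convert! hn using 4; ring
    have h1 : (1 + x ^ n) * |laguerre α k x| ≤ 2 * D * Real.exp (x / 2) := by
      have : |laguerre α k x| ≤ D * Real.exp (x / 2) := h0.trans (by gcongr)
      linarith
    calc _ = ((1 + x ^ n) * |laguerre α k x|) * Real.exp (-(‖u‖ ^ 2 / 4)) := by ring
      _ ≤ (2 * D * Real.exp (x / 2)) * Real.exp (-(‖u‖ ^ 2 / 4)) := by gcongr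
      _ = 2 * D := by rw [mul_assoc, hE, mul_one]
  have hpow : (1 + ‖u‖) ^ (2 * n) ≤ 8 ^ n * (1 + x ^ n) := by
    have h2 : (1 + ‖u‖) ^ 2 ≤ 4 * max 1 (2 * x) := by
      have h3 : 2 * x = ‖u‖ ^ 2 := by rw [hx]; ring
      rw [h3]
      nlinarith [le_max_left 1 (‖u‖ ^ 2), le_max_right 1 (‖u‖ ^ 2), sq_nonneg (‖u‖ - 1)]
    rw [pow_mul]
    calc ((1 + ‖u‖) ^ 2) ^ n ≤ (4 * max 1 (2 * x)) ^ n := by gcongr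
      _ = 4 ^ n * max 1 (2 * x) ^ n := mul_pow _ _ _
      _ ≤ 4 ^ n * (2 ^ n * (1 + x ^ n)) := by
        gcongr
        have h2 : (1 : ℝ) ≤ 2 ^ n := one_le_pow₀ (by norm_num)
        rcases max_cases (1 : ℝ) (2 * x) with ⟨h, -⟩ | ⟨h, -⟩ <;> rw [h]
        · rw [one_pow]; nlinarith [pow_nonneg hx0 n]
        · rw [mul_pow]; nlinarith [pow_nonneg hx0 n]
      _ = 8 ^ n * (1 + x ^ n) := by rw [← mul_assoc, ← mul_pow]; norm_num
  calc _ ≤ |laguerreFun α k u| * (8 ^ n * (1 + x ^ n)) := by gcongr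
    _ = 8 ^ n * ((1 + x ^ n) * |laguerreFun α k u|) := by ring
    _ ≤ 8 ^ n * (2 * D) := by gcongr
    _ = _ := by rw [hD, show (32 : ℝ) = 8 * 4 by norm_num, mul_pow]; ring

lemma summable_add_pow_mul_geometric {r b : ℝ} (hr0 : 0 ≤ r) (hr1 : r < 1) (hb : 0 ≤ b) (p : ℕ) :
    Summable fun j : ℕ => r ^ j * ((j : ℝ) + b) ^ p := by
  have h1 : Summable fun j : ℕ => ((j : ℝ) ^ p) * r ^ j :=
    summable_pow_mul_geometric_of_norm_lt_one p (by rwa [Real.norm_of_nonneg hr0])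
  have h2 : Summable fun j : ℕ => r ^ j := summable_geometric_of_lt_one hr0 hr1
  refine Summable.of_nonneg_of_le (fun j => by positivity) (fun j => ?_)
    ((h1.add (h2.mul_left (b ^ p))).mul_left (2 ^ p))
  have h3 : ((j : ℝ) + b) ^ p ≤ 2 ^ p * ((j : ℝ) ^ p + b ^ p) := by
    calc ((j : ℝ) + b) ^ p ≤ (2 * max (j : ℝ) b) ^ p := by
          gcongr
          linarith [le_max_left (j : ℝ) b, le_max_right (j : ℝ) b]
      _ = 2 ^ p * max (j : ℝ) b ^ p := mul_pow _ _ _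
      _ ≤ _ := by
          gcongr
          rcases max_cases (j : ℝ) b with ⟨h, -⟩ | ⟨h, -⟩ <;> rw [h]
          · linarith [pow_nonneg hb p]
          · linarith [pow_nonneg (Nat.cast_nonneg (α := ℝ) j) p]
  calc r ^ j * ((j : ℝ) + b) ^ p ≤ r ^ j * (2 ^ p * ((j : ℝ) ^ p + b ^ p)) := by gcongr
    _ = _ := by ring

lemma hasSum_projKernel {α : ℕ} {s : ℝ} (hs : 0 < s) (hs1 : s < 1) (z w : Cn (α + 1)) :
    HasSum (fun k : ℕ => (((1 - s ^ 2) ^ k : ℝ) : ℂ) * projKernel α k z w)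
      (heatKernel (α + 1) s z w) := by
  have h := hasSum_laguerre α (r := 1 - s ^ 2) (by nlinarith) (by nlinarith) (‖w - z‖ ^ 2 / 2)
  have h2 := (h.mul_left ((1 / (2 * Real.pi)) ^ (α + 1) * Real.exp (-(‖w - z‖ ^ 2 / 4))))
  have h3 := ((Complex.hasSum_ofReal.2 h2).mul_right (phaseFactor w z))
  convert! h3 using 1
  · funext k
    simp only [projKernel, laguerreFun]
    push_cast
    ring
  · rw [heatKernel]
    congr 2
    rw [sub_sub_cancel, mul_assoc, mul_assoc]
    congr 1
    rw [mul_left_comm, ← Real.exp_add, inv_pow, pow_mul, inv_pow]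
    congr 2
    field_simp
    ring

lemma hasSum_integral_projKernel {α : ℕ} {s : ℝ} (hs : 0 < s) (hs1 : s < 1) (z : Cn (α + 1))
    (f : L2 (α + 1)) :
    HasSum (fun k : ℕ => (((1 - s ^ 2) ^ k : ℝ) : ℂ) * ∫ w, projKernel α k z w * f w)
      (∫ w, heatKernel (α + 1) s z w * f w) := by
  have hr0 : 0 ≤ 1 - s ^ 2 := by nlinarith
  have hr1 : 1 - s ^ 2 < 1 := by nlinarith
  -- Makes (1 + ‖w‖)^{-2n} square integrable, since 4n exceeds the real dimension 2(α + 1).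
  set n : ℕ := α + 2 with hn
  set c₀ : ℝ := (1 / (2 * Real.pi)) ^ (α + 1) with hc₀
  have hc₀0 : 0 ≤ c₀ := by positivity
  let W : Cn (α + 1) → ℂ := fun w => ((((1 + ‖w - z‖) ^ (2 * n))⁻¹ : ℝ) : ℂ)
  have hW0 : MemLp (fun w : Cn (α + 1) => ((((1 + ‖w‖) ^ (2 * n))⁻¹ : ℝ) : ℂ)) 2 := by
    have hc : Continuous (fun w : Cn (α + 1) => ((((1 + ‖w‖) ^ (2 * n))⁻¹ : ℝ) : ℂ)) := by
      refine Complex.continuous_ofReal.comp (Continuous.inv₀ (by fun_prop) fun w => ?_)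
      positivity
    rw [memLp_two_iff_integrable_sq_norm hc.aestronglyMeasurable]
    have h := integrable_one_add_norm (E := Cn (α + 1)) (μ := volume) (r := ((4 * n : ℕ) : ℝ))
      (by rw [finrank_Cn, hn]; exact_mod_cast (by omega))
    refine h.congr (Filter.Eventually.of_forall fun w => ?_)
    simp only
    rw [Real.rpow_neg (by positivity), Real.rpow_natCast, Complex.norm_real,
      Real.norm_of_nonneg (by positivity), inv_pow, ← pow_mul]
    congr 2; ring
  have hW : MemLp W 2 := hW0.comp_measurePreserving (measurePreserving_sub_right volume z)
  have hWf := integrable_norm_mul_norm hW (Lp.memLp f)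
  have hb : ∀ k w, ‖projKernel α k z w‖ ≤
      c₀ * (2 * 32 ^ n * ((k : ℝ) + (α + n + 1)) ^ (α + n)) * ‖W w‖ := by
    intro k w
    rw [norm_projKernel, mul_assoc]
    refine mul_le_mul_of_nonneg_left ?_ hc₀0
    simp only [W]
    rw [Complex.norm_real, Real.norm_of_nonneg (by positivity), ← div_eq_mul_inv,
      le_div_iff₀ (by positivity)]
    exact abs_laguerreFun_mul_le α k n (w - z)
  have hint : ∀ k, Integrable
      (fun w => (((1 - s ^ 2) ^ k : ℝ) : ℂ) * (projKernel α k z w * f w)) :=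
    fun k => (integrable_projKernel_mul α k z f).const_mul _
  have key := hasSum_integral_of_summable_integral_norm hint ?_
  · simp only [integral_const_mul] at key
    convert! key using 1
    refine integral_congr_ae (Filter.Eventually.of_forall fun w => ?_)
    simp only [← mul_assoc]
    rw [tsum_mul_right, (hasSum_projKernel hs hs1 z w).tsum_eq]
  · set I := ∫ w, ‖W w‖ * ‖f w‖ with hI
    have hI0 : 0 ≤ I := by positivity
    refine Summable.of_nonneg_of_le (fun k => by positivity) (fun k => ?_)
      ((summable_add_pow_mul_geometric hr0 hr1 (b := α + n + 1) (by positivity) (α + n)).mul_left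
        (c₀ * (2 * 32 ^ n) * I))
    have e : ∫ w, ‖(((1 - s ^ 2) ^ k : ℝ) : ℂ) * (projKernel α k z w * f w)‖ ≤
        ∫ w, ((1 - s ^ 2) ^ k * (c₀ * (2 * 32 ^ n * ((k : ℝ) + (α + n + 1)) ^ (α + n)))) *
          (‖W w‖ * ‖f w‖) := by
      refine integral_mono (hint k).norm (hWf.const_mul _) fun w => ?_
      simp only
      rw [norm_mul, norm_mul, Complex.norm_real, Real.norm_of_nonneg (by positivity), mul_assoc,
        ← mul_assoc _ ‖W w‖]
      gcongr
      exact hb k w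
    rw [integral_const_mul] at e
    refine e.trans (le_of_eq ?_)
    ring

/-- The function is even bounded: by translation invariance the L² norm of the kernel in its second
variable does not depend on z. -/
lemma locallyIntegrable_integral_projKernel (α k : ℕ) (f : L2 (α + 1)) :
    LocallyIntegrable fun z => ∫ w, projKernel α k z w * f w := by
  have hm : StronglyMeasurable fun z => ∫ w, projKernel α k z w * f w := by
    refine StronglyMeasurable.integral_prod_right
      (f := fun z w => projKernel α k z w * f w) ?_
    exact (continuous_projKernel α k).stronglyMeasurable.mul
      ((Lp.stronglyMeasurable f).comp_measurable measurable_snd)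
  let c₀ : ℝ := (1 / (2 * Real.pi)) ^ (α + 1)
  have hc : LocallyIntegrable (fun _ : Cn (α + 1) =>
      (∫ u : Cn (α + 1), (c₀ * |laguerreFun α k u|) ^ 2) + ∫ w, ‖f w‖ ^ 2) :=
    locallyIntegrable_const _
  refine hc.mono hm.aestronglyMeasurable (Filter.Eventually.of_forall fun z => ?_)
  refine (norm_integral_le_integral_norm _).trans ?_
  simp only [norm_mul]
  refine (integral_norm_mul_norm_le (memLp_projKernel α k z) (Lp.memLp f)).trans ?_
  simp only [norm_projKernel]
  rw [integral_sub_right_eq_self (fun u : Cn (α + 1) => (c₀ * |laguerreFun α k u|) ^ 2) z]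
  exact le_abs_self _

/-- By orthogonality only the k-th term of the Abel sum survives; the heat integral of f is (1 -
s²)^k times the right side, and s → 0. -/
lemma ae_eq_integral_projKernel_of_mem_eigenspace {α k : ℕ} {f : L2 (α + 1)}
    (hf : f ∈ eigenspace (α + 1) (α + 1 + 2 * k)) :
    f =ᵐ[volume] fun z => ∫ w, projKernel α k z w * f w := by
  refine ae_eq_of_integral_heatKernel_mul (Lp.stronglyMeasurable f) (Lp.memLp f)
    (locallyIntegrable_integral_projKernel α k f) k fun s hs hs1 z => ?_
  refine (hasSum_integral_projKernel hs hs1 z f).unique (hasSum_single k fun j hj => ?_)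
  rw [integral_projKernel_mul_of_mem_eigenspace hf, mul_zero]
  intro h
  apply hj
  have : (k : ℝ) = j := by linarith
  exact_mod_cast this.symm

/-- Every term of the Abel sum vanishes, hence so does its limit f. -/
lemma eq_zero_of_mem_eigenspace {α : ℕ} {lam : ℝ} (hlam : ∀ k : ℕ, lam ≠ α + 1 + 2 * k)
    {f : L2 (α + 1)} (hf : f ∈ eigenspace (α + 1) lam) : f = 0 := by
  refine (Lp.eq_zero_iff_ae_eq_zero (f := f)).2 ?_
  refine ae_eq_of_integral_heatKernel_mul (Lp.stronglyMeasurable f) (Lp.memLp f)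
    (locallyIntegrable_const (0 : ℂ)) 0 fun s hs hs1 z => ?_
  rw [Pi.zero_apply, mul_zero]
  refine (hasSum_integral_projKernel hs hs1 z f).unique ?_
  simp only [integral_projKernel_mul_of_mem_eigenspace hf (hlam _), mul_zero]
  exact hasSum_zero

/-- The kernel kills the part of f orthogonal to the eigenspace, its slices being conjugates of
eigenfunctions, and reproduces the rest. -/
lemma spectralProj_ae_eq (α k : ℕ) (f : L2 (α + 1)) :
    spectralProj (α + 1) (α + 1 + 2 * k) f =ᵐ[volume] fun z => ∫ w, projKernel α k z w * f w := by
  set E := eigenspace (α + 1) (α + 1 + 2 * k) with hE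
  have h1 : E.starProjection f ∈ E := E.starProjection_apply_mem f
  have h2 : f - E.starProjection f ∈ Eᗮ := E.sub_starProjection_mem_orthogonal f
  have h3 : ∀ z, ∫ w, projKernel α k z w * f w =
      ∫ w, projKernel α k z w * (E.starProjection f : L2 (α + 1)) w := by
    intro z
    have h4 := integral_projKernel_mul_of_mem_orthogonal h2 z
    rw [← sub_eq_zero, ← integral_sub (integrable_projKernel_mul α k z f)
      (integrable_projKernel_mul α k z _), ← h4]
    refine integral_congr_ae ?_
    filter_upwards [Lp.coeFn_sub f (E.starProjection f)] with w hw
    rw [hw, Pi.sub_apply, mul_sub]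
  simp only [h3]
  exact ae_eq_integral_projKernel_of_mem_eigenspace h1

lemma spectralProj_eq_zero {α : ℕ} {lam : ℝ} (hlam : ∀ k : ℕ, lam ≠ α + 1 + 2 * k)
    (f : L2 (α + 1)) : spectralProj (α + 1) lam f = 0 :=
  eq_zero_of_mem_eigenspace hlam ((eigenspace (α + 1) lam).starProjection_apply_mem f)

/-! ### The continuous kernel of the multiplier -/

lemma multiplier_eq_sum {α : ℕ} {m : ℝ → ℂ} {K : ℕ} (hK : ∀ k : ℕ, K ≤ k → m (α + 1 + 2 * k) = 0)
    (f : L2 (α + 1)) :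
    multiplier (α + 1) m f =
      ∑ k ∈ Finset.range K, m (α + 1 + 2 * k) • spectralProj (α + 1) (α + 1 + 2 * k) f := by
  classical
  unfold multiplier
  have hinj : Function.Injective fun k : ℕ => (α + 1 + 2 * k : ℝ) := by
    intro a b h
    simpa using h
  rw [tsum_eq_sum (s := (Finset.range K).image fun k : ℕ => (α + 1 + 2 * k : ℝ))]
  · exact Finset.sum_image hinj.injOn
  · intro lam hlam
    by_cases h : ∃ k : ℕ, lam = α + 1 + 2 * k
    · obtain ⟨k, rfl⟩ := h
      rw [hK k, zero_smul]
      by_contra hk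
      exact hlam (Finset.mem_image.2 ⟨k, Finset.mem_range.2 (not_le.1 hk), rfl⟩)
    · rw [spectralProj_eq_zero (not_exists.1 h), smul_zero]

lemma isKernel_multiplier {α : ℕ} {m : ℝ → ℂ} {K : ℕ}
    (hK : ∀ k : ℕ, K ≤ k → m (α + 1 + 2 * k) = 0) :
    IsKernel (multiplier (α + 1) m) fun z w =>
      ∑ k ∈ Finset.range K, m (α + 1 + 2 * k) * projKernel α k z w := by
  intro f
  have hint : ∀ z k, Integrable fun w => m (α + 1 + 2 * (k : ℕ)) * (projKernel α k z w * f w) :=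
    fun z k => (integrable_projKernel_mul α k z f).const_mul _
  have h1 := Lp.coeFn_finsetSum (Finset.range K)
    fun k : ℕ => m (α + 1 + 2 * k) • spectralProj (α + 1) (α + 1 + 2 * k) f
  have h2 : ∀ᵐ z : Cn (α + 1), ∀ k : ℕ,
      (m (α + 1 + 2 * k) • spectralProj (α + 1) (α + 1 + 2 * k) f : L2 (α + 1)) z =
        m (α + 1 + 2 * k) * ∫ w, projKernel α k z w * f w := by
    rw [ae_all_iff]
    intro k
    filter_upwards [Lp.coeFn_smul (m (α + 1 + 2 * k)) (spectralProj (α + 1) (α + 1 + 2 * k) f),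
      spectralProj_ae_eq α k f] with z hz1 hz2
    rw [hz1, Pi.smul_apply, hz2, smul_eq_mul]
  filter_upwards [h1, h2] with z hz1 hz2
  simp only [Finset.sum_mul, mul_assoc]
  refine ⟨integrable_finsetSum _ fun k _ => hint z k, ?_⟩
  rw [multiplier_eq_sum hK, hz1, Finset.sum_apply, integral_finsetSum _ fun k _ => hint z k]
  exact Finset.sum_congr rfl fun k _ => by rw [hz2, integral_const_mul]

/-- An operator has at most one continuous integral kernel. -/
lemma IsKernel.eq_of_continuous {d : ℕ} {T : L2 d → L2 d} {K K' : Cn d → Cn d → ℂ}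
    (hK : IsKernel T K) (hK' : IsKernel T K') (hc : Continuous (Function.uncurry K))
    (hc' : Continuous (Function.uncurry K')) : K = K' := by
  by_contra hne
  obtain ⟨z₀, hz₀⟩ := Function.ne_iff.1 hne
  obtain ⟨w₀, hw₀⟩ := Function.ne_iff.1 hz₀
  let D : Cn d × Cn d → ℂ := fun p => K p.1 p.2 - K' p.1 p.2
  have hD : Continuous D := hc.sub hc'
  set a := D (z₀, w₀) with ha
  have ha0 : 0 < ‖a‖ := norm_pos_iff.2 (sub_ne_zero.2 hw₀)
  obtain ⟨δ, hδ, hball⟩ := Metric.continuous_iff.1 hD (z₀, w₀) (‖a‖ / 2) (by positivity)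
  have hfin : volume (Metric.ball w₀ δ) ≠ ⊤ := Metric.isBounded_ball.measure_lt_top.ne
  set S := Metric.ball w₀ δ with hS
  have hSm : MeasurableSet S := Metric.isOpen_ball.measurableSet
  -- Near (z₀, w₀) the difference of the kernels stays within ‖a‖/2 of a ≠ 0, so its integral over a
  -- small ball cannot vanish; equality of the operators on this indicator forces it to vanish for
  -- almost every z.
  let f : L2 d := indicatorConstLp 2 hSm hfin (1 : ℂ)
  have hfae : (f : Cn d → ℂ) =ᵐ[volume] S.indicator fun _ => 1 := indicatorConstLp_coeFn
  have hz : ∀ᵐ z : Cn d, ∫ w in S, D (z, w) = 0 := by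
    filter_upwards [hK f, hK' f] with z h1 h2
    have h3 : ∫ w, (K z w * f w - K' z w * f w) = 0 := by
      rw [integral_sub h1.1 h2.1, ← h1.2, ← h2.2, sub_self]
    rw [← integral_indicator hSm, ← h3]
    refine integral_congr_ae ?_
    filter_upwards [hfae] with w hw
    rw [hw]
    by_cases hwS : w ∈ S
    · simp [hwS, D]
    · simp [hwS]
  obtain ⟨z, hzb, hz0⟩ : ∃ z ∈ Metric.ball z₀ δ, ∫ w in S, D (z, w) = 0 := by
    by_contra hcon
    push Not at hcon
    have hpos : 0 < volume (Metric.ball z₀ δ) := Metric.measure_ball_pos volume z₀ hδ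
    have hnull : volume (Metric.ball z₀ δ) = 0 :=
      measure_mono_null (fun z hzb => hcon z hzb) (ae_iff.1 hz)
    exact hpos.ne' hnull
  have hmpos : 0 < (volume S).toReal :=
    ENNReal.toReal_pos (Metric.measure_ball_pos volume w₀ hδ).ne' hfin
  have hDint : IntegrableOn (fun w => D (z, w)) S :=
    ((hD.comp (Continuous.prodMk_right z)).continuousOn.integrableOn_compact
      (isCompact_closedBall w₀ δ)).mono_set Metric.ball_subset_closedBall
  have h4 : ‖∫ w in S, (D (z, w) - a)‖ ≤ ‖a‖ / 2 * (volume S).toReal := by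
    refine norm_setIntegral_le_of_norm_le_const hfin.lt_top fun w hw => ?_
    rw [← dist_eq_norm]
    refine (hball (z, w) ?_).le
    rw [Prod.dist_eq]
    exact max_lt hzb hw
  rw [integral_sub hDint (integrableOn_const hfin), hz0, zero_sub, norm_neg, setIntegral_const,
    norm_smul, Measure.real, Real.norm_of_nonneg hmpos.le] at h4
  nlinarith

/-- The continuous integral kernel of a spectral multiplier with finitely many terms. -/
noncomputable def multiplierKernel (α K : ℕ) (m : ℝ → ℂ) (z w : Cn (α + 1)) : ℂ :=
  ∑ k ∈ Finset.range K, m (α + 1 + 2 * k) * projKernel α k z w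

lemma continuous_multiplierKernel (α K : ℕ) (m : ℝ → ℂ) :
    Continuous (Function.uncurry (multiplierKernel α K m)) := by
  have h := continuous_finsetSum (Finset.range K) fun k _ =>
    (continuous_projKernel α k).const_mul (m (α + 1 + 2 * k))
  exact h

/-- The phase is common to all k and drops out; the factor (2π)^{-(α+1)} ≤ 1 is discarded. -/
lemma norm_multiplierKernel_le (α K : ℕ) (m : ℝ → ℂ) (z w : Cn (α + 1)) :
    ‖multiplierKernel α K m z w‖ ≤
      ‖∑ k ∈ Finset.range K, m (α + 1 + 2 * k) * (laguerre α k (‖z - w‖ ^ 2 / 2) : ℂ)‖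
        * Real.exp (-(‖z - w‖ ^ 2 / 4)) := by
  have h : multiplierKernel α K m z w =
      (((1 / (2 * Real.pi)) ^ (α + 1) * Real.exp (-(‖z - w‖ ^ 2 / 4)) : ℝ) : ℂ) * phaseFactor w z *
      ∑ k ∈ Finset.range K, m (α + 1 + 2 * k) * (laguerre α k (‖z - w‖ ^ 2 / 2) : ℂ) := by
    rw [multiplierKernel, Finset.mul_sum]
    refine Finset.sum_congr rfl fun k _ => ?_
    rw [projKernel, laguerreFun, norm_sub_rev w z]
    push_cast
    ring
  rw [h, norm_mul, norm_mul, norm_phaseFactor, mul_one, Complex.norm_real,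
    Real.norm_of_nonneg (by positivity), mul_comm]
  refine mul_le_mul_of_nonneg_left ?_ (norm_nonneg _)
  refine mul_le_of_le_one_left (Real.exp_pos _).le (pow_le_one₀ (by positivity) ?_)
  rw [div_le_one (by positivity)]
  linarith [Real.pi_gt_three]

end TwistedLaplacian
-- The three regimes
theorem lemma2p5 (d : ℕ) (hd : 1 ≤ d) (N : ℝ) (hN : 0 < N) (c : ℝ) (hc : 0 < c) :
    ∃ (M : ℕ) (C : ℝ), 0 < C ∧
      ∀ η : ℝ → ℂ, ContDiff ℝ ∞ η → HasCompactSupport η → tsupport η ⊆ Set.Ioo (-2) 2 →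
      ∀ A : ℝ, (∀ k ≤ M, ∀ s : ℝ, ‖iteratedDeriv k η s‖ ≤ A) →
      ∀ μ R : ℝ, 1 ≤ μ → 0 < R →
        (∃ K : Cn d → Cn d → ℂ, Continuous (Function.uncurry K) ∧
          IsKernel (multiplier d fun s => η ((μ - s) / R)) K) ∧
        ∀ K : Cn d → Cn d → ℂ, Continuous (Function.uncurry K) →
          IsKernel (multiplier d fun s => η ((μ - s) / R)) K →
          ∀ z w : Cn d,
            (μ ≤ R → c * R ^ (-(1 / 2) : ℝ) ≤ ‖z - w‖ →
              ‖K z w‖ ≤ C * A * R ^ d * (1 + R ^ (1 / 2 : ℝ) * ‖z - w‖) ^ (-N)) ∧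
            (1 ≤ R → R < μ → c * (μ ^ (1 / 2 : ℝ) * R⁻¹) ≤ ‖z - w‖ →
              ‖K z w‖ ≤ C * A * R ^ d * (1 + R * μ ^ (-(1 / 2) : ℝ) * ‖z - w‖) ^ (-N)) ∧
            (R < 1 → c * μ ^ (1 / 2 : ℝ) ≤ ‖z - w‖ →
              ‖K z w‖ ≤ C * A * (1 + μ ^ (-(1 / 2) : ℝ) * ‖z - w‖) ^ (-N)) := by
  obtain ⟨α, rfl⟩ : ∃ α, d = α + 1 := ⟨d - 1, by omega⟩
  obtain ⟨M, C, hC, h⟩ := exists_norm_sum_laguerre_le α N c hc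
  refine ⟨M, C, hC, fun η hη _ hsupp A hA μ R hμ hR => ?_⟩
  set m : ℝ → ℂ := fun s => η ((μ - s) / R) with hm
  -- For k ≥ μ + 2R the argument of η lies below -2, outside its support.
  set K₀ : ℕ := ⌈μ + 2 * R⌉₊ with hK₀
  have hvan : ∀ k : ℤ, K₀ ≤ k → m (α + 1 + 2 * k) = 0 := by
    intro k hk
    by_contra hne
    have h1 := (hsupp (subset_tsupport _ (Function.mem_support.2 hne))).1
    rw [lt_div_iff₀ hR] at h1
    have h2 : μ + 2 * R ≤ K₀ := Nat.le_ceil _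
    have h3 : (K₀ : ℝ) ≤ k := by exact_mod_cast hk
    have h4 : (0 : ℝ) ≤ α := Nat.cast_nonneg α
    linarith
  have hker : IsKernel (multiplier (α + 1) m) (multiplierKernel α K₀ m) :=
    isKernel_multiplier fun k hk => by simpa using hvan k (by exact_mod_cast hk)
  refine ⟨⟨_, continuous_multiplierKernel α K₀ m, hker⟩, fun K hKc hK z w => ?_⟩
  obtain rfl : K = multiplierKernel α K₀ m :=
    hK.eq_of_continuous hker hKc (continuous_multiplierKernel α K₀ m)
  have hbound := fun ρ κ hρ hκ hs => (norm_multiplierKernel_le α K₀ m z w).trans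
    (h η hη hsupp A hA μ R hμ hR K₀ hvan ρ κ ‖z - w‖ hρ hκ hs)
  have hsq : ∀ x : ℝ, 0 < x → x ^ (-(1 / 2) : ℝ) = (√x)⁻¹ := fun x hx => by
    rw [Real.rpow_neg hx.le, Real.sqrt_eq_rpow]
  simp only [← Real.sqrt_eq_rpow, hsq R hR, hsq μ (by linarith)]
  have hsR : √R * √R = R := Real.mul_self_sqrt hR.le
  have hsR0 : 0 < √R := Real.sqrt_pos.2 hR
  -- The pairs (ρ, κ) are (R, R), (R, μ) and (1, μ); √κ/ρ and ρ/√κ then give the stated scales.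
  refine ⟨fun h1 h2 => ?_, fun h1 h2 h3 => ?_, fun h1 h2 => ?_⟩
  · have e1 : √R / R = (√R)⁻¹ := by rw [div_eq_iff hR.ne']; nth_rw 3 [← hsR]; field_simp
    have e2 : R / √R = √R := by rw [div_eq_iff hsR0.ne', hsR]
    have := hbound R R (max_eq_right (by linarith)).symm (max_eq_right h1).symm (by rwa [e1])
    rwa [e2] at this
  · exact hbound R μ (max_eq_right h1).symm (max_eq_left h2.le).symm h3
  · have := hbound 1 μ (max_eq_left h1.le).symm (max_eq_left hμ).symm (by rwa [div_one])
    simpa only [one_pow, mul_one, one_div] using this
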